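/- Let $d,K,m,J$ be natural numbers, $X=\mathbb R^d$, $y\in\mathbb R^K$, let $\Gamma\in\mathbb R^{K\times K}$ and $C_0\in\mathbb R^{d\times d}$ be symmetric positive definite, $\lambda>0$, $\tau>0$, and let $G:X\to\mathbb R^K$ and $h_1,\dots,h_m:X\to\mathbb R$. Put $$\Phi^{\mathrm{reg}}(u)=\tfrac12\langle G(u)-y,\Gamma^{-1}(G(u)-y)\rangle+\tfrac{\lambda}{2}\langle u,C_0^{-1}u\rangle,\qquad \Phi^b(u)=\Phi^{\mathrm{reg}}(u)-\frac1\tau\sum_{i=1}^m\log(-h_i(u)),$$ where $\Phi^b(u)$ is understood to be $+\infty$ unless $h_i(u)<0$ for all $i$. Assume: 1. $\Phi^{\mathrm{reg}}$ is $C^2$; for some $\mu>0$, $\Phi^{\mathrm{reg}}(x_1)-\Phi^{\mathrm{reg}}(x_2)\ge\langle\nabla\Phi^{\mathrm{reg}}(x_2),x_1-x_2\rangle+\frac\mu2\|x_1-x_2\|^2$ for all $x_1,x_2\in X$; and $\nabla\Phi^{\mathrm{reg}}$ is $L$-Lipschitz on $X$ for some $L>0$. 2. $G$ is locally Lipschitz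 and differentiable, and for some $b_{res}$, $\|G(x_1)-G(x_2)-DG(x_2)(x_1-x_2)\|\le b_{res}\|x_1-x_2\|^2$ for all $x_1,x_2\in X$. 3. Each $h_i$ is convex and $C^1$, and there is $u\in X$ with $h_i(u)<0$ for all $i$. For an ensemble $u=(u^{(j)})_{j=1}^J$ in $X$ write $\bar u=\frac1J\sum_j u^{(j)}$, $\bar G(u)=\frac1J\sum_jG(u^{(j)})$, $\widehat C(u)=\frac1J\sum_j(u^{(j)}-\bar u)\otimes(u^{(j)}-\bar u)$ and $\widehat C^{u,G}=\frac1J\sum_j(u^{(j)}-\bar u)\otimes(G(u^{(j)})-\bar G(u))$. Let $\rho:[0,\infty)\to[0,1]$ satisfy $\rho_t\to1$ as $t\to\infty$. Let $J>d$ and let $(u_t^{(j)})_{t\ge0}$, $j=1,\dots,J$, be a solution on $[0,\infty)$ of the covariance-inflated log-barrier EKI flow $$\frac{\mathrm d u_t^{(j)}}{\mathrm dt}=-\widehat C_t^{u,G}\Gamma^{-1}(G(u_t^{(j)})-y)-\lambda\,\widehat C(u_t)C_0^{-1}u_t^{(j)}+\rho_t\,\widehat C_t^{u,G}\Gamma^{-1}(G(u_t^{(j)})-\bar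 G(u_t))+\frac1\tau\widehat C(u_t)\sum_{i=1}^m\frac{1}{h_i(\bar u_t)}\nabla h_i(\bar u_t)$$ (in particular $h_i(\bar u_t)\ne0$ for all $i$ and $t$), such that $h_i(\bar u_0)<0$ for all $i$ and the initial empirical covariance $\widehat C(u_0)$ is positive definite. Let $u_*^\tau$ be the global minimiser of $\Phi^b$. Then $h_i(\bar u_t)<0$ for all $i$ and all $t\ge0$. Moreover, for every $$\gamma>\max\Big\{1,\frac{\lambda\,\sigma_{\max}}{\mu}\Big\},\qquad \sigma_{\max}=\|C_0^{-1}\|\ \text{(the largest eigenvalue of }C_0^{-1}),$$ a range that depends neither on $t$ nor on $\tau$, there exist $c_1,c_2>0$ and $\bar t\ge0$ such that $$\Phi^b(\bar u_t)-\Phi^b(u_*^\tau)\le\Big(\frac{c_1}{t+c_2}\Big)^{1/\gamma}\qquad\text{for all }t\ge\bar t .$$ In particular $\lim_{t\to\infty}\big(\Phi^b(\bar u_t)-\Phi^b(u_*^\tau)\big)=0$. -/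

import Mathlib

open Filter Topology

namespace EKI

noncomputable section

/-- Euclidean space `ℝⁿ`. -/
abbrev Vec (n : ℕ) : Type := EuclideanSpace ℝ (Fin n)

/-- A square matrix acting on Euclidean space. -/
def act {n : ℕ} (M : Matrix (Fin n) (Fin n) ℝ) : Vec n →L[ℝ] Vec n :=
  Matrix.toEuclideanCLM (n := Fin n) (𝕜 := ℝ) M

/-- The Tikhonov regularised potential
`Φ^reg(u) = ½ ⟨G(u) - y, Γ⁻¹ (G(u) - y)⟩ + (lam / 2) ⟨u, C₀⁻¹ u⟩`. -/
def regPotential {d K : ℕ} (G : Vec d → Vec K) (y : Vec K)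
    (Γ : Matrix (Fin K) (Fin K) ℝ) (C₀ : Matrix (Fin d) (Fin d) ℝ) (lam : ℝ) (u : Vec d) : ℝ :=
  1 / 2 * inner ℝ (G u - y) (act Γ⁻¹ (G u - y)) + lam / 2 * inner ℝ u (act C₀⁻¹ u)

/-- Strict feasibility: `h_i(u) < 0` for every constraint. -/
def StrictlyFeasible {d m : ℕ} (h : Fin m → Vec d → ℝ) (u : Vec d) : Prop :=
  ∀ i, h i u < 0

/-- The log-barrier potential `Φ^b(u) = Φ(u) - (1/τ) ∑ i, log (-h_i(u))` attached to an
objective `Φ`.  It is meant only at strictly feasible points (elsewhere it is `+∞` by convention,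
and the value below is not used). -/
def barrierPotential {d m : ℕ} (Φ : Vec d → ℝ) (h : Fin m → Vec d → ℝ) (τ : ℝ) (u : Vec d) : ℝ :=
  Φ u - 1 / τ * ∑ i, Real.log (-(h i u))

/-- `v` is a global minimiser of the log-barrier potential (which is `+∞` at the points that are
not strictly feasible). -/
def IsBarrierMinimiser {d m : ℕ} (Φ : Vec d → ℝ) (h : Fin m → Vec d → ℝ) (τ : ℝ)
    (v : Vec d) : Prop :=
  StrictlyFeasible h v ∧
    ∀ w, StrictlyFeasible h w → barrierPotential Φ h τ v ≤ barrierPotential Φ h τ w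

/-- The mean of a finite family of vectors. -/
def mean {J n : ℕ} (x : Fin J → Vec n) : Vec n :=
  (1 / (J : ℝ)) • ∑ j, x j

/-- The empirical cross-covariance `(1/J) ∑ j, (x_j - x̄) ⊗ (z_j - z̄)`, as an operator;
`(a ⊗ b) w = ⟨b, w⟩ a`. -/
def crossCov {J n k : ℕ} (x : Fin J → Vec n) (z : Fin J → Vec k) : Vec k →L[ℝ] Vec n :=
  (1 / (J : ℝ)) • ∑ j, InnerProductSpace.rankOne ℝ (x j - mean x) (z j - mean z)

/-- The empirical covariance `Ĉ(x)`. -/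
def cov {J n : ℕ} (x : Fin J → Vec n) : Vec n →L[ℝ] Vec n :=
  crossCov x x

/-- The drift of particle `j` of the Tikhonov regularised EKI with inflation factors `ρ`
(on the data misfit) and `β` (on the regularisation). -/
def inflatedDrift {d K J : ℕ} (G : Vec d → Vec K) (y : Vec K)
    (Γ : Matrix (Fin K) (Fin K) ℝ) (C₀ : Matrix (Fin d) (Fin d) ℝ) (lam ρ β : ℝ)
    (u : Fin J → Vec d) (j : Fin J) : Vec d :=
  -(crossCov u (fun k => G (u k)) (act Γ⁻¹ (G (u j) - y)))
    - lam • cov u (act C₀⁻¹ (u j))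
    + ρ • crossCov u (fun k => G (u k)) (act Γ⁻¹ (G (u j) - mean (fun k => G (u k))))
    + (β * lam) • cov u (act C₀⁻¹ (u j - mean u))

/-- The log-barrier force `(1/τ) Ĉ(u) ∑ i, (1 / h_i(ū)) ∇h_i(ū)`, common to all particles. -/
def barrierForce {d m J : ℕ} (h : Fin m → Vec d → ℝ) (τ : ℝ) (u : Fin J → Vec d) : Vec d :=
  (1 / τ) • cov u (∑ i, (1 / h i (mean u)) • gradient (h i) (mean u))

/-- `u` is a solution on `[0, ∞)` of the covariance-inflated log-barrier EKI flow: the right-hand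
side is defined along `u` (no `h_i(ū_t)` vanishes) and every particle satisfies its equation. -/
structure IsFlowSolution {d K m J : ℕ} (G : Vec d → Vec K) (y : Vec K)
    (Γ : Matrix (Fin K) (Fin K) ℝ) (C₀ : Matrix (Fin d) (Fin d) ℝ) (lam : ℝ)
    (h : Fin m → Vec d → ℝ) (τ : ℝ) (ρ β : ℝ → ℝ) (u : ℝ → Fin J → Vec d) : Prop where
  ne_zero : ∀ t, 0 ≤ t → ∀ i, h i (mean (u t)) ≠ 0
  hasDeriv : ∀ t, 0 ≤ t → ∀ j,
    HasDerivWithinAt (fun s => u s j)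
      (inflatedDrift G y Γ C₀ lam (ρ t) (β t) (u t) j + barrierForce h τ (u t)) (Set.Ici 0) t

end

end EKI

/-!
Along the flow the barrier potential of the ensemble mean is almost a Lyapunov function. If `n` is
the gradient of `Φ^b` at the mean `ū`, the velocity of `ū` is `-Ĉ n` up to the error committed by
replacing `Ĉ^{u,G}` by `Ĉ DG(ū)ᵀ` and the mean of the `G(u^{(j)})` by `G(ū)`. The remainder of `G`
being quadratic, this error perturbs the dissipation `⟨n, Ĉ n⟩` by at most a fraction `η` of itself
plus a multiple of `(tr Ĉ)² (1 + ‖DG(ū)‖ + ‖G(ū) - y‖)² / η`.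

The inflation does not act on the mean, and on the covariance it only weakens the misfit term, so
`dĈ/dt ≤ -2 lam Ĉ C₀⁻¹ Ĉ` and `tr Ĉ ≤ q / (t + 1)`. By strong convexity `‖DG‖²` and `‖G - y‖²` grow
at most linearly in the gap `f = Φ^b(ū) - Φ^b(u_*)`, so the perturbation is `O((1 + f) / (t + 1)²)`;
its coefficient is integrable in time and `f` stays bounded.

For the rate one needs `Ĉ` from below. As `ρ_t → 1`, the misfit term eventually contributes at most
`ε / (t + 1)` times `Ĉ`, and the Riccati inequality satisfied by `Ĉ⁻¹` gives `Ĉ⁻¹ ≤ S (t + 1)` for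
every `S > 2 lam ‖C₀⁻¹‖` and all large `t`. With the Polyak–Łojasiewicz inequality `2 μ f ≤ ‖n‖²`,
which `Φ^b` inherits from the strong convexity of `Φ^reg`, this yields
`f' ≤ -(1 - η) (2 μ / S) f / (t + 1) + O((t + 1)⁻²)`. When `γ > max 1 (lam ‖C₀⁻¹‖ / μ)`, a choice of
`S < 2 μ γ` and of a small `η` makes the coefficient equal to `1 / γ < 1`, and `f` decays like
`(t + 1)^(-1 / γ)`.
-/

namespace EKI

section DifferentialInequalities

lemma antitoneOn_of_hasDerivWithinAt {f f' : ℝ → ℝ} {D : Set ℝ} (hD : Convex ℝ D)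
    (hf : ∀ t ∈ D, HasDerivWithinAt f (f' t) D t) (hf' : ∀ t ∈ D, f' t ≤ 0) :
    AntitoneOn f D :=
  antitoneOn_of_hasDerivWithinAt_nonpos hD (fun t ht => (hf t ht).continuousWithinAt)
    (fun t ht => (hf t (interior_subset ht)).mono interior_subset)
    (fun t ht => hf' t (interior_subset ht))

lemma antitoneOn_mul_integratingFactor_sub {f f' w g a b : ℝ → ℝ} {D : Set ℝ} (hD : Convex ℝ D)
    (hf : ∀ t ∈ D, HasDerivWithinAt f (f' t) D t)
    (hw : ∀ t ∈ D, HasDerivWithinAt w (-a t * w t) D t)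
    (hg : ∀ t ∈ D, HasDerivWithinAt g (b t * w t) D t) (hw₀ : ∀ t ∈ D, 0 ≤ w t)
    (hle : ∀ t ∈ D, f' t ≤ a t * f t + b t) :
    AntitoneOn (fun t => f t * w t - g t) D := by
  refine antitoneOn_of_hasDerivWithinAt hD
    (fun t ht => ((hf t ht).mul (hw t ht)).sub (hg t ht)) fun t ht => ?_
  calc f' t * w t + f t * (-a t * w t) - b t * w t = (f' t - (a t * f t + b t)) * w t := by ring
    _ ≤ 0 := mul_nonpos_of_nonpos_of_nonneg (sub_nonpos.mpr (hle t ht)) (hw₀ t ht)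

lemma le_mul_exp_of_deriv_le_mul {f f' a A : ℝ → ℝ} {T : ℝ}
    (hf : ∀ t ∈ Set.Ici T, HasDerivWithinAt f (f' t) (Set.Ici T) t)
    (hA : ∀ t ∈ Set.Ici T, HasDerivWithinAt A (a t) (Set.Ici T) t)
    (hle : ∀ t ∈ Set.Ici T, f' t ≤ a t * f t) {t : ℝ} (ht : T ≤ t) :
    f t ≤ f T * Real.exp (A t - A T) := by
  have hanti := antitoneOn_mul_integratingFactor_sub (w := fun s => Real.exp (-A s))
    (g := fun _ => 0) (b := fun _ => 0) (convex_Ici T) hf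
    (fun s hs => (hA s hs).neg.exp.congr_deriv (mul_comm _ _))
    (fun s _ => (hasDerivWithinAt_const s _ _).congr_deriv (zero_mul _).symm)
    (fun s _ => (Real.exp_pos _).le) (fun s hs => (hle s hs).trans_eq (add_zero _).symm)
  have h : f t * Real.exp (-A t) ≤ f T * Real.exp (-A T) := by
    simpa using hanti Set.self_mem_Ici ht ht
  calc f t = f t * Real.exp (-A t) * Real.exp (A t) := by
        rw [mul_assoc, ← Real.exp_add, neg_add_cancel, Real.exp_zero, mul_one]
    _ ≤ f T * Real.exp (-A T) * Real.exp (A t) := by gcongr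
    _ = f T * Real.exp (A t - A T) := by
        rw [mul_assoc, ← Real.exp_add, neg_add_eq_sub]

lemma one_add_le_mul_exp_of_deriv_le {f f' : ℝ → ℝ} {M : ℝ} (hM : 0 ≤ M) (hf₀ : 0 ≤ 1 + f 0)
    (hf : ∀ t ∈ Set.Ici (0 : ℝ), HasDerivWithinAt f (f' t) (Set.Ici 0) t)
    (hle : ∀ t ∈ Set.Ici (0 : ℝ), f' t ≤ M / (t + 1) ^ 2 * (1 + f t)) {t : ℝ} (ht : 0 ≤ t) :
    1 + f t ≤ (1 + f 0) * Real.exp M := by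
  have hA : ∀ s ∈ Set.Ici (0 : ℝ),
      HasDerivWithinAt (fun x => -M * (x + 1)⁻¹) (M / (s + 1) ^ 2) (Set.Ici 0) s := fun s hs => by
    have hs₁ : s + 1 ≠ 0 := (add_pos_of_nonneg_of_pos hs one_pos).ne'
    refine ((((hasDerivWithinAt_id s _).add_const 1).inv hs₁).const_mul (-M)).congr_deriv ?_
    simp only [id]
    ring
  refine (le_mul_exp_of_deriv_le_mul (fun s hs => (hf s hs).const_add 1) hA hle ht).trans ?_
  gcongr
  have htail : 0 ≤ M * (t + 1)⁻¹ := mul_nonneg hM (by positivity)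
  rw [zero_add, inv_one]
  linarith

lemma mul_exp_le_of_le_deriv {φ φ' : ℝ → ℝ} {M : ℝ}
    (hφ : ∀ t ∈ Set.Ici (0 : ℝ), HasDerivWithinAt φ (φ' t) (Set.Ici 0) t)
    (hle : ∀ t ∈ Set.Ici (0 : ℝ), -M * φ t ≤ φ' t) {t : ℝ} (ht : 0 ≤ t) :
    φ 0 * Real.exp (-M * t) ≤ φ t := by
  have h := le_mul_exp_of_deriv_le_mul (f := fun s => -φ s) (a := fun _ => -M)
    (A := fun s => -M * s) (fun s hs => (hφ s hs).neg)
    (fun s _ => ((hasDerivWithinAt_id s _).const_mul (-M)).congr_deriv (mul_one _))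
    (fun s hs => by linarith [hle s hs]) ht
  simp only [mul_zero, sub_zero, neg_mul] at h ⊢
  linarith

lemma hasDerivWithinAt_add_one_rpow (p : ℝ) {t : ℝ} (ht : 0 ≤ t) (D : Set ℝ) :
    HasDerivWithinAt (fun x : ℝ => (x + 1) ^ p) (p * (t + 1) ^ (p - 1)) D t := by
  have h : HasDerivWithinAt (fun x : ℝ => x + 1) 1 D t := (hasDerivWithinAt_id t D).add_const 1
  simpa using h.rpow_const (p := p) (Or.inl (by positivity))

/-- The bound is the solution of the Cauchy–Euler equation `f' = p f / (t + 1) + M (t + 1) ^ r`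
with the same value at `T`; it has this form because `r + 1 ≠ p` excludes resonance. -/
lemma le_cauchyEuler_of_deriv_le {f f' : ℝ → ℝ} {p r M T : ℝ} (hT : 0 ≤ T) (hpr : r + 1 - p ≠ 0)
    (hf : ∀ t ∈ Set.Ici T, HasDerivWithinAt f (f' t) (Set.Ici T) t)
    (hle : ∀ t ∈ Set.Ici T, f' t ≤ p / (t + 1) * f t + M * (t + 1) ^ r) {t : ℝ} (ht : T ≤ t) :
    f t ≤ (f T * (T + 1) ^ (-p) - M / (r + 1 - p) * (T + 1) ^ (r + 1 - p)) * (t + 1) ^ p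
      + M / (r + 1 - p) * (t + 1) ^ (r + 1) := by
  have hpos : ∀ s ∈ Set.Ici T, 0 < s + 1 := fun s hs =>
    add_pos_of_nonneg_of_pos (hT.trans hs) one_pos
  have hanti := antitoneOn_mul_integratingFactor_sub (w := fun s => (s + 1) ^ (-p))
    (g := fun s => M / (r + 1 - p) * (s + 1) ^ (r + 1 - p)) (convex_Ici T) hf
    (fun s hs => (hasDerivWithinAt_add_one_rpow (-p) (hT.trans hs) _).congr_deriv (by
      rw [Real.rpow_sub_one (hpos s hs).ne']; ring))
    (fun s hs =>
      ((hasDerivWithinAt_add_one_rpow (r + 1 - p) (hT.trans hs) _).const_mul _).congr_deriv (by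
        rw [mul_assoc M, ← Real.rpow_add (hpos s hs), ← mul_assoc, div_mul_cancel₀ _ hpr]
        ring_nf))
    (fun s hs => (Real.rpow_pos_of_pos (hpos s hs) _).le) hle
  have h : f t * (t + 1) ^ (-p) ≤ f T * (T + 1) ^ (-p)
      - M / (r + 1 - p) * (T + 1) ^ (r + 1 - p) + M / (r + 1 - p) * (t + 1) ^ (r + 1 - p) :=
    sub_le_iff_le_add.mp (hanti Set.self_mem_Ici ht ht)
  have ht₁ : 0 < t + 1 := hpos t ht
  have hcancel : ∀ x : ℝ, (t + 1) ^ (x - p) * (t + 1) ^ p = (t + 1) ^ x := fun x => by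
    rw [← Real.rpow_add ht₁, sub_add_cancel]
  calc f t = f t * (t + 1) ^ (-p) * (t + 1) ^ p := by
        rw [← zero_sub p, mul_assoc, hcancel, Real.rpow_zero, mul_one]
    _ ≤ _ := mul_le_mul_of_nonneg_right h (Real.rpow_nonneg ht₁.le p)
    _ = _ := by rw [add_mul, mul_assoc (M / _), hcancel]

lemma le_max_div_of_deriv_le_neg_sq {φ φ' : ℝ → ℝ} {a : ℝ} (ha : 0 < a)
    (hφ₀ : ∀ t ∈ Set.Ici (0 : ℝ), 0 ≤ φ t)
    (hφ : ∀ t ∈ Set.Ici (0 : ℝ), HasDerivWithinAt φ (φ' t) (Set.Ici 0) t)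
    (hle : ∀ t ∈ Set.Ici (0 : ℝ), φ' t ≤ -a * φ t ^ 2) {t : ℝ} (ht : 0 ≤ t) :
    φ t ≤ max (φ 0) (1 / a) / (t + 1) := by
  set M := max (φ 0) (1 / a)
  have hM : 0 < M := lt_max_of_lt_right (by positivity)
  rcases (hφ₀ t ht).eq_or_lt with hzero | hpos
  · rw [← hzero]; positivity
  have hanti : AntitoneOn φ (Set.Ici 0) := antitoneOn_of_hasDerivWithinAt (convex_Ici 0) hφ
    fun s hs => (hle s hs).trans (by nlinarith [sq_nonneg (φ s)])
  have hφ_pos : ∀ s ∈ Set.Icc 0 t, 0 < φ s := fun s hs => hpos.trans_le (hanti hs.1 ht hs.2)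
  have hinv : AntitoneOn (fun s => a * s - (φ s)⁻¹) (Set.Icc 0 t) := by
    refine antitoneOn_of_hasDerivWithinAt (convex_Icc 0 t)
      (fun s hs => ((hasDerivWithinAt_id s _).const_mul a).sub
        (((hφ s hs.1).mono Set.Icc_subset_Ici_self).inv (hφ_pos s hs).ne')) fun s hs => ?_
    have : a ≤ -φ' s / φ s ^ 2 := by
      rw [le_div_iff₀ (pow_pos (hφ_pos s hs) 2)]
      linarith [hle s hs.1]
    linarith
  have hgrow : a * t + (φ 0)⁻¹ ≤ (φ t)⁻¹ := by
    have := hinv ⟨le_rfl, ht⟩ ⟨ht, le_rfl⟩ ht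
    simp only [mul_zero, zero_sub] at this
    linarith
  have hM₀ : M⁻¹ ≤ (φ 0)⁻¹ := inv_anti₀ (hφ_pos 0 ⟨le_rfl, ht⟩) (le_max_left _ _)
  have hMa : M⁻¹ ≤ a := inv_le_of_inv_le₀ ha ((one_div a).symm.le.trans (le_max_right _ _))
  rw [← inv_le_inv₀ (div_pos hM (by positivity)) hpos, inv_div, div_eq_mul_inv]
  nlinarith

lemma exists_le_rpow_of_dissipation {f f' D : ℝ → ℝ} {α κ A T : ℝ} (hα : 0 < α) (hα₁ : α < 1)
    (hακ : α < κ) (hA : 0 ≤ A) (hT : 0 ≤ T)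
    (hf : ∀ t ∈ Set.Ici T, HasDerivWithinAt f (f' t) (Set.Ici T) t)
    (hdiss : ∀ t ∈ Set.Ici T, ∀ η : ℝ, 0 < η → f' t ≤ -(1 - η) * D t + A / η / (t + 1) ^ 2)
    (hD : ∀ t ∈ Set.Ici T, κ * f t ≤ (t + 1) * D t) :
    ∃ c : ℝ, 0 < c ∧ ∀ t ∈ Set.Ici T, f t ≤ c * (t + 1) ^ (-α) := by
  have hκ : 0 < κ := hα.trans hακ
  have hη : 0 < 1 - α / κ := sub_pos.mpr ((div_lt_one hκ).mpr hακ)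
  set M := A / (1 - α / κ)
  have hM : 0 ≤ M := by positivity
  have hle : ∀ t ∈ Set.Ici T, f' t ≤ -α / (t + 1) * f t + M * (t + 1) ^ (-2 : ℝ) := by
    intro t ht
    have ht₁ : 0 < t + 1 := add_pos_of_nonneg_of_pos (hT.trans ht) one_pos
    have hDt : α / (t + 1) * f t ≤ α / κ * D t := by
      calc α / (t + 1) * f t = α / (κ * (t + 1)) * (κ * f t) := by field_simp
        _ ≤ α / (κ * (t + 1)) * ((t + 1) * D t) :=
          mul_le_mul_of_nonneg_left (hD t ht) (by positivity)
        _ = α / κ * D t := by field_simp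
    have h := hdiss t ht _ hη
    rw [Real.rpow_neg ht₁.le, Real.rpow_two, ← div_eq_mul_inv, neg_div, neg_mul]
    linarith
  set c := f T * (T + 1) ^ (- -α) - M / (-2 + 1 - -α) * (T + 1) ^ (-2 + 1 - -α)
  refine ⟨max c 1, by positivity, fun t ht => ?_⟩
  have ht₁ : 0 ≤ t + 1 := by linarith [hT.trans ht]
  have hneg : M / (-2 + 1 - -α) * (t + 1) ^ ((-2 : ℝ) + 1) ≤ 0 :=
    mul_nonpos_of_nonpos_of_nonneg (div_nonpos_of_nonneg_of_nonpos hM (by linarith))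
      (Real.rpow_nonneg ht₁ _)
  calc f t ≤ c * (t + 1) ^ (-α) + M / (-2 + 1 - -α) * (t + 1) ^ ((-2 : ℝ) + 1) :=
        le_cauchyEuler_of_deriv_le hT (by linarith) hf hle ht
    _ ≤ c * (t + 1) ^ (-α) := add_le_of_nonpos_right hneg
    _ ≤ max c 1 * (t + 1) ^ (-α) := by gcongr; exact le_max_left _ _

lemma eventually_linear_add_rpow_le {a S B ε : ℝ} (ha : a < S) (hε : ε < 1) :
    ∀ᶠ t : ℝ in atTop, a * (t + 1) + B * (t + 1) ^ ε ≤ S * (t + 1) := by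
  have hlim : Tendsto (fun t : ℝ => B * (t + 1) ^ (-(1 - ε))) atTop (𝓝 0) := by
    simpa using ((tendsto_rpow_neg_atTop (sub_pos.mpr hε)).comp
      (tendsto_atTop_add_const_right atTop (1 : ℝ) tendsto_id)).const_mul B
  filter_upwards [hlim.eventually_le_const (sub_pos.mpr ha), eventually_ge_atTop 0] with t hBt ht
  have ht₁ : 0 < t + 1 := by linarith
  calc a * (t + 1) + B * (t + 1) ^ ε = (a + B * (t + 1) ^ (-(1 - ε))) * (t + 1) := by
        rw [add_mul, mul_assoc B, ← Real.rpow_add_one ht₁.ne']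
        ring_nf
    _ ≤ S * (t + 1) := by gcongr; linarith

lemma tendsto_zero_of_le_div_rpow {f : ℝ → ℝ} {γ c₁ c₂ T : ℝ} (hγ : 0 < γ)
    (hf : ∀ t, 0 ≤ t → 0 ≤ f t) (hle : ∀ t, T ≤ t → f t ≤ (c₁ / (t + c₂)) ^ (1 / γ)) :
    Tendsto f atTop (𝓝 0) := by
  have hlim : Tendsto (fun t : ℝ => (c₁ / (t + c₂)) ^ (1 / γ)) atTop (𝓝 0) := by
    simpa [hγ.ne'] using ((tendsto_atTop_add_const_right atTop c₂ tendsto_id).const_div_atTop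
      c₁).rpow_const (p := 1 / γ) (Or.inr (by positivity))
  refine tendsto_of_tendsto_of_tendsto_of_le_of_le' tendsto_const_nhds hlim ?_ ?_
  · filter_upwards [eventually_ge_atTop 0] with t ht using hf t ht
  · filter_upwards [eventually_ge_atTop T] with t ht using hle t ht

end DifferentialInequalities

section Operators

variable {E : Type*} [NormedAddCommGroup E] [InnerProductSpace ℝ E]

lemma inner_apply_sq_le {T : E →L[ℝ] E} (hT : T.IsPositive) (x y : E) :
    inner ℝ x (T y) ^ 2 ≤ inner ℝ x (T x) * inner ℝ y (T y) := by
  let B : LinearMap.BilinForm ℝ E := (innerₗ E).compl₂ (T : E →ₗ[ℝ] E)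
  exact LinearMap.BilinForm.apply_sq_le_of_symm B (fun z => hT.inner_nonneg_right z)
    ⟨fun z w => by
      simpa [B, real_inner_comm] using hT.inner_left_eq_inner_right w z⟩ x y

lemma norm_apply_sq_le {T : E →L[ℝ] E} (hT : T.IsPositive) {B : ℝ}
    (hB : ∀ x, inner ℝ x (T x) ≤ B * ‖x‖ ^ 2) (x : E) :
    ‖T x‖ ^ 2 ≤ B * inner ℝ x (T x) := by
  rcases eq_or_ne (T x) 0 with hzero | hne
  · simp [hzero]
  refine le_of_mul_le_mul_left ?_ (by positivity : 0 < ‖T x‖ ^ 2)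
  calc ‖T x‖ ^ 2 * ‖T x‖ ^ 2 = inner ℝ (T x) (T x) ^ 2 := by
        rw [real_inner_self_eq_norm_sq, ← sq]
    _ ≤ inner ℝ (T x) (T (T x)) * inner ℝ x (T x) := inner_apply_sq_le hT _ _
    _ ≤ B * ‖T x‖ ^ 2 * inner ℝ x (T x) :=
        mul_le_mul_of_nonneg_right (hB _) (hT.inner_nonneg_right x)
    _ = ‖T x‖ ^ 2 * (B * inner ℝ x (T x)) := by ring

lemma inner_apply_le_opNorm (T : E →L[ℝ] E) (x : E) : inner ℝ x (T x) ≤ ‖T‖ * ‖x‖ ^ 2 :=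
  calc inner ℝ x (T x) ≤ ‖x‖ * ‖T x‖ := real_inner_le_norm _ _
    _ ≤ ‖x‖ * (‖T‖ * ‖x‖) := by gcongr; exact T.le_opNorm x
    _ = ‖T‖ * ‖x‖ ^ 2 := by ring

lemma apply_inverse_apply {T : E →L[ℝ] E} (hT : IsUnit T) (x : E) : T (Ring.inverse T x) = x :=
  congrArg (fun S : E →L[ℝ] E => S x) (Ring.mul_inverse_cancel T hT)

lemma norm_sq_le_of_inner_inverse_le {T : E →L[ℝ] E} (hT : T.IsPositive) (hunit : IsUnit T) {v : E}
    {a : ℝ} (ha : inner ℝ v (Ring.inverse T v) ≤ a * ‖v‖ ^ 2) : ‖v‖ ^ 2 ≤ a * inner ℝ v (T v) := by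
  rcases eq_or_ne v 0 with rfl | hv
  · simp
  have hinv : inner ℝ (Ring.inverse T v) (T (Ring.inverse T v)) ≤ a * ‖v‖ ^ 2 := by
    rwa [apply_inverse_apply hunit, real_inner_comm]
  refine le_of_mul_le_mul_left ?_ (by positivity : 0 < ‖v‖ ^ 2)
  calc ‖v‖ ^ 2 * ‖v‖ ^ 2 = inner ℝ v (T (Ring.inverse T v)) ^ 2 := by
        rw [apply_inverse_apply hunit, real_inner_self_eq_norm_sq, ← sq]
    _ ≤ inner ℝ v (T v) * inner ℝ (Ring.inverse T v) (T (Ring.inverse T v)) :=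
        inner_apply_sq_le hT _ _
    _ ≤ inner ℝ v (T v) * (a * ‖v‖ ^ 2) :=
        mul_le_mul_of_nonneg_left hinv (hT.inner_nonneg_right v)
    _ = ‖v‖ ^ 2 * (a * inner ℝ v (T v)) := by ring

lemma isUnit_of_inner_pos [FiniteDimensional ℝ E] {T : E →L[ℝ] E}
    (hT : ∀ v, v ≠ 0 → 0 < inner ℝ v (T v)) : IsUnit T := by
  have := FiniteDimensional.complete ℝ E
  have hinj : Function.Injective (T : E →ₗ[ℝ] E) := by
    refine (injective_iff_map_eq_zero _).mpr fun v hv => ?_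
    by_contra hne
    simpa [show T v = 0 from hv] using hT v hne
  exact ContinuousLinearMap.isUnit_iff_bijective.mpr
    ⟨hinj, LinearMap.injective_iff_surjective.mp hinj⟩

lemma isBoundedBilinearMap_rankOne :
    IsBoundedBilinearMap ℝ (fun p : E × E => InnerProductSpace.rankOne ℝ p.1 p.2) where
  add_left _ _ _ := by simp
  smul_left _ _ _ := by simp
  add_right _ _ _ := by simp
  smul_right _ _ _ := by simp
  bound := ⟨1, one_pos, fun _ _ => by simp⟩

section Curves

variable {C : ℝ → E →L[ℝ] E} {D : Set ℝ} {t : ℝ}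

lemma hasDerivWithinAt_inner_apply {C' : E →L[ℝ] E} (hC : HasDerivWithinAt C C' D t) (v : E) :
    HasDerivWithinAt (fun s => inner ℝ v (C s v)) (inner ℝ v (C' v)) D t := by
  simpa using (hasDerivWithinAt_const t D v).inner ℝ (hC.clm_apply (hasDerivWithinAt_const t D v))

variable [CompleteSpace E]

lemma hasDerivWithinAt_inverse {C' : E →L[ℝ] E} (hC : HasDerivWithinAt C C' D t)
    (hunit : IsUnit (C t)) :
    HasDerivWithinAt (fun s => Ring.inverse (C s))
      (-(Ring.inverse (C t) * C' * Ring.inverse (C t))) D t := by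
  obtain ⟨U, hU⟩ := hunit
  have h := hasFDerivAt_ringInverse (𝕜 := ℝ) U
  rw [hU] at h
  exact (h.comp_hasDerivWithinAt t hC).congr_deriv (by simp [← hU])

lemma hasDerivWithinAt_inner_inverse (hD : UniqueDiffWithinAt ℝ D t)
    (hC : DifferentiableWithinAt ℝ C D t) (hunit : IsUnit (C t)) (hpos : (C t).IsPositive)
    {r : E → ℝ} (hr : ∀ v, HasDerivWithinAt (fun s => inner ℝ v (C s v)) (r v) D t) (v : E) :
    HasDerivWithinAt (fun s => inner ℝ v (Ring.inverse (C s) v))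
      (-r (Ring.inverse (C t) v)) D t := by
  have hC' := hC.hasDerivWithinAt
  set C' := derivWithin C D t
  set w := Ring.inverse (C t) v
  refine (hasDerivWithinAt_inner_apply (hasDerivWithinAt_inverse hC' hunit) v).congr_deriv ?_
  calc inner ℝ v (-(Ring.inverse (C t) (C' w)))
      = -inner ℝ (C t w) (Ring.inverse (C t) (C' w)) := by
        rw [inner_neg_right, apply_inverse_apply hunit]
    _ = -inner ℝ w (C' w) := by
        rw [hpos.inner_left_eq_inner_right, apply_inverse_apply hunit]
    _ = -r w := by rw [hD.eq_deriv _ (hasDerivWithinAt_inner_apply hC' w) (hr w)]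

lemma inner_inverse_le_of_riccati {r : ℝ → E → ℝ} {T s ε : ℝ} (hT : 0 ≤ T) (hs : 0 ≤ s)
    (hε : 0 ≤ ε) (hε₁ : ε < 1) (hC : ∀ t ∈ Set.Ici T, DifferentiableWithinAt ℝ C (Set.Ici T) t)
    (hpos : ∀ t ∈ Set.Ici T, (C t).IsPositive) (hunit : ∀ t ∈ Set.Ici T, IsUnit (C t))
    (hr : ∀ t ∈ Set.Ici T, ∀ v,
      HasDerivWithinAt (fun a => inner ℝ v (C a v)) (r t v) (Set.Ici T) t)
    (hle : ∀ t ∈ Set.Ici T, ∀ v, -(ε / (t + 1) * inner ℝ v (C t v) + s * ‖C t v‖ ^ 2) ≤ r t v)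
    (ht : T ≤ t) (v : E) :
    inner ℝ v (Ring.inverse (C t) v) ≤
      (s / (1 - ε) * (t + 1) + ‖Ring.inverse (C T)‖ * (t + 1) ^ ε) * ‖v‖ ^ 2 := by
  have hriccati : ∀ a ∈ Set.Ici T, -r a (Ring.inverse (C a) v) ≤
      ε / (a + 1) * inner ℝ v (Ring.inverse (C a) v) + s * ‖v‖ ^ 2 * (a + 1) ^ (0 : ℝ) := by
    intro a ha
    have h := hle a ha (Ring.inverse (C a) v)
    rw [apply_inverse_apply (hunit a ha), real_inner_comm] at h
    rw [Real.rpow_zero, mul_one]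
    linarith
  have h := le_cauchyEuler_of_deriv_le hT (by linarith)
    (fun a ha => hasDerivWithinAt_inner_inverse (uniqueDiffOn_Ici T a ha) (hC a ha) (hunit a ha)
      (hpos a ha) (hr a ha) v) hriccati ht
  rw [zero_add, Real.rpow_one] at h
  have hT₁ : (T + 1) ^ (-ε) ≤ 1 := Real.rpow_le_one_of_one_le_of_nonpos (by linarith) (by linarith)
  have hinit : inner ℝ v (Ring.inverse (C T) v) * (T + 1) ^ (-ε) ≤
      ‖Ring.inverse (C T)‖ * ‖v‖ ^ 2 := by
    calc _ ≤ ‖Ring.inverse (C T)‖ * ‖v‖ ^ 2 * (T + 1) ^ (-ε) := by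
          gcongr; exact inner_apply_le_opNorm _ v
      _ ≤ _ := mul_le_of_le_one_right (by positivity) hT₁
  have hdrop : 0 ≤ s * ‖v‖ ^ 2 / (1 - ε) * (T + 1) ^ (1 - ε) := by
    have : 0 < 1 - ε := sub_pos.mpr hε₁
    positivity
  have ht₁ : 0 ≤ (t + 1) ^ ε := Real.rpow_nonneg (by linarith) ε
  refine h.trans ?_
  calc _ ≤ ‖Ring.inverse (C T)‖ * ‖v‖ ^ 2 * (t + 1) ^ ε + s * ‖v‖ ^ 2 / (1 - ε) * (t + 1) := by
        gcongr
        linarith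
    _ = _ := by ring

lemma eventually_norm_sq_le_of_riccati {r : ℝ → E → ℝ} {T s S ε : ℝ} (hT : 0 ≤ T) (hs : 0 ≤ s)
    (hε : 0 ≤ ε) (hε₁ : ε < 1) (hS : s / (1 - ε) < S)
    (hC : ∀ t ∈ Set.Ici T, DifferentiableWithinAt ℝ C (Set.Ici T) t)
    (hpos : ∀ t ∈ Set.Ici T, (C t).IsPositive) (hunit : ∀ t ∈ Set.Ici T, IsUnit (C t))
    (hr : ∀ t ∈ Set.Ici T, ∀ v,
      HasDerivWithinAt (fun a => inner ℝ v (C a v)) (r t v) (Set.Ici T) t)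
    (hle : ∀ t ∈ Set.Ici T, ∀ v, -(ε / (t + 1) * inner ℝ v (C t v) + s * ‖C t v‖ ^ 2) ≤ r t v) :
    ∀ᶠ t in atTop, ∀ v, ‖v‖ ^ 2 ≤ S * (t + 1) * inner ℝ v (C t v) := by
  filter_upwards [eventually_ge_atTop T,
    eventually_linear_add_rpow_le (B := ‖Ring.inverse (C T)‖) hS hε₁] with t ht hlin v
  refine norm_sq_le_of_inner_inverse_le (hpos t ht) (hunit t ht) ?_
  exact (inner_inverse_le_of_riccati hT hs hε hε₁ hC hpos hunit hr hle ht v).trans (by gcongr)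

end Curves

end Operators

section MatrixAction

variable {n : ℕ} {M : Matrix (Fin n) (Fin n) ℝ}

lemma isPositive_act (hM : M.PosSemidef) : (act M).IsPositive := by
  rw [← ContinuousLinearMap.isPositive_toLinearMap_iff, act,
    Matrix.coe_toEuclideanCLM_eq_toEuclideanLin, Matrix.isPositive_toEuclideanLin_iff]
  exact hM

lemma exists_coercive_act_inv (hM : M.PosDef) :
    ∃ g : ℝ, 0 < g ∧ ∀ x : Vec n, g * ‖x‖ ^ 2 ≤ inner ℝ x (act M⁻¹ x) := by
  refine ⟨(‖act M‖ + 1)⁻¹, by positivity, fun x => ?_⟩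
  have hcancel : act M (act M⁻¹ x) = x := by
    have hmul : act M * act M⁻¹ = 1 := by
      rw [act, act, ← map_mul, Matrix.mul_nonsing_inv _ hM.det_pos.ne'.isUnit, map_one]
    exact congrArg (fun T => T x) hmul
  have hnorm := norm_apply_sq_le (isPositive_act hM.posSemidef) (inner_apply_le_opNorm (act M))
    (act M⁻¹ x)
  rw [hcancel, real_inner_comm] at hnorm
  have hnonneg := (isPositive_act hM.inv.posSemidef).inner_nonneg_right x
  rw [inv_mul_le_iff₀ (by positivity)]
  linarith

end MatrixAction

section Ensemble

variable {J n k : ℕ}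

lemma mean_add (x z : Fin J → Vec n) : mean (fun j => x j + z j) = mean x + mean z := by
  simp [mean, Finset.sum_add_distrib]

lemma mean_neg (x : Fin J → Vec n) : mean (fun j => -x j) = -mean x := by
  simp [mean]

lemma mean_sub (x z : Fin J → Vec n) : mean (fun j => x j - z j) = mean x - mean z := by
  simp [mean, Finset.sum_sub_distrib, smul_sub]

lemma mean_map (T : Vec n →L[ℝ] Vec k) (x : Fin J → Vec n) :
    mean (fun j => T (x j)) = T (mean x) := by
  simp [mean]

lemma mean_const (hJ : 0 < J) (v : Vec n) : mean (fun _ : Fin J => v) = v := by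
  simp only [mean, Finset.sum_const, Finset.card_univ, Fintype.card_fin]
  rw [← Nat.cast_smul_eq_nsmul ℝ, smul_smul, one_div, inv_mul_cancel₀ (by positivity), one_smul]

lemma norm_mean_le {x : Fin J → Vec n} {w : Fin J → ℝ} (h : ∀ j, ‖x j‖ ≤ w j) :
    ‖mean x‖ ≤ 1 / (J : ℝ) * ∑ j, w j := by
  rw [mean, norm_smul, Real.norm_of_nonneg (by positivity)]
  gcongr
  exact norm_sum_le_of_le _ fun j _ => h j

lemma mean_sub_mean (hJ : 0 < J) (x : Fin J → Vec n) : mean (fun j => x j - mean x) = 0 := by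
  rw [mean_sub, mean_const hJ, sub_self]

lemma sum_sub_mean (hJ : 0 < J) (x : Fin J → Vec n) : ∑ j, (x j - mean x) = 0 := by
  have h := mean_sub_mean hJ x
  rw [mean, smul_eq_zero] at h
  exact h.resolve_left (by positivity)

lemma inner_crossCov (x : Fin J → Vec n) (z : Fin J → Vec k) (v : Vec n) (w : Vec k) :
    inner ℝ v (crossCov x z w) =
      1 / (J : ℝ) * ∑ j, inner ℝ (x j - mean x) v * inner ℝ (z j - mean z) w := by
  simp only [crossCov, smul_apply, sum_apply, inner_smul_right, inner_sum,
    InnerProductSpace.rankOne_apply]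
  congr 1
  refine Finset.sum_congr rfl fun j _ => ?_
  rw [real_inner_comm v, mul_comm]

lemma inner_crossCov_comm (x : Fin J → Vec n) (z : Fin J → Vec k) (v : Vec n) (w : Vec k) :
    inner ℝ v (crossCov x z w) = inner ℝ w (crossCov z x v) := by
  simp only [inner_crossCov, mul_comm]

lemma inner_cov (x : Fin J → Vec n) (v : Vec n) :
    inner ℝ v (cov x v) = 1 / (J : ℝ) * ∑ j, inner ℝ (x j - mean x) v ^ 2 := by
  simp only [cov, inner_crossCov, sq]

lemma isPositive_cov (x : Fin J → Vec n) : (cov x).IsPositive :=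
  (ContinuousLinearMap.isPositive_sum _ fun _ _ =>
    InnerProductSpace.isPositive_rankOne_self _).smul_of_nonneg (by positivity)

lemma inner_cov_nonneg (x : Fin J → Vec n) (v : Vec n) : 0 ≤ inner ℝ v (cov x v) :=
  (isPositive_cov x).inner_nonneg_right v

/-- The mean square deviation of an ensemble from its mean, that is, the trace of its empirical
covariance. -/
noncomputable def spread (x : Fin J → Vec n) : ℝ := 1 / (J : ℝ) * ∑ j, ‖x j - mean x‖ ^ 2

lemma spread_nonneg (x : Fin J → Vec n) : 0 ≤ spread x := by
  unfold spread; positivity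

lemma spread_eq_sum_inner_cov {ι : Type*} [Fintype ι] (e : OrthonormalBasis ι ℝ (Vec n))
    (x : Fin J → Vec n) : spread x = ∑ i, inner ℝ (e i) (cov x (e i)) := by
  simp only [inner_cov, ← Finset.mul_sum, spread]
  rw [Finset.sum_comm]
  simp only [← e.sum_sq_norm_inner_left, Real.norm_eq_abs, sq_abs]

lemma norm_sub_mean_sq_le (hJ : 0 < J) (x : Fin J → Vec n) (j : Fin J) :
    ‖x j - mean x‖ ^ 2 ≤ J * spread x := by
  rw [spread, ← mul_assoc, mul_one_div_cancel (by positivity), one_mul]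
  exact Finset.single_le_sum (f := fun j => ‖x j - mean x‖ ^ 2)
    (fun i _ => by positivity) (Finset.mem_univ j)

lemma spread_le (hJ : 0 < J) (x : Fin J → Vec n) (c : Vec n) :
    spread x ≤ 1 / (J : ℝ) * ∑ j, ‖x j - c‖ ^ 2 := by
  have hcross : ∑ j, 2 * inner ℝ (x j - mean x) (mean x - c) = 0 := by
    rw [← Finset.mul_sum, ← sum_inner, sum_sub_mean hJ, inner_zero_left, mul_zero]
  have hsplit : ∑ j, ‖x j - c‖ ^ 2 =
      ∑ j, ‖x j - mean x‖ ^ 2 + ∑ _j : Fin J, ‖mean x - c‖ ^ 2 := by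
    rw [← add_zero (∑ j, ‖x j - mean x‖ ^ 2), ← hcross, ← Finset.sum_add_distrib,
      ← Finset.sum_add_distrib]
    simp only [← norm_add_sq_real, sub_add_sub_cancel]
  rw [hsplit, spread]
  gcongr
  exact le_add_of_nonneg_right (by positivity)

lemma inner_cov_le (x : Fin J → Vec n) (v : Vec n) :
    inner ℝ v (cov x v) ≤ spread x * ‖v‖ ^ 2 := by
  rw [inner_cov, spread, mul_assoc, Finset.sum_mul]
  gcongr with j
  rw [← mul_pow, ← sq_abs]
  gcongr
  exact abs_real_inner_le_norm _ _

lemma inner_crossCov_sq_le (x : Fin J → Vec n) (z : Fin J → Vec k) (v : Vec n) (w : Vec k) :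
    inner ℝ v (crossCov x z w) ^ 2 ≤ inner ℝ v (cov x v) * inner ℝ w (cov z w) := by
  rw [inner_crossCov, inner_cov, inner_cov, mul_mul_mul_comm, mul_pow, ← sq]
  gcongr
  exact Finset.sum_mul_sq_le_sq_mul_sq _ _ _

lemma norm_crossCov_sq_le (x : Fin J → Vec n) (z : Fin J → Vec k) (v : Vec n) :
    ‖crossCov z x v‖ ^ 2 ≤ spread z * inner ℝ v (cov x v) := by
  set w := crossCov z x v with hw
  rcases eq_or_ne w 0 with hzero | hne
  · rw [hzero, norm_zero, zero_pow two_ne_zero]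
    exact mul_nonneg (spread_nonneg z) (inner_cov_nonneg x v)
  refine le_of_mul_le_mul_left ?_ (by positivity : 0 < ‖w‖ ^ 2)
  calc ‖w‖ ^ 2 * ‖w‖ ^ 2 = inner ℝ w (crossCov z x v) ^ 2 := by
        rw [← hw, real_inner_self_eq_norm_sq, ← sq]
    _ ≤ inner ℝ w (cov z w) * inner ℝ v (cov x v) := inner_crossCov_sq_le z x w v
    _ ≤ spread z * ‖w‖ ^ 2 * inner ℝ v (cov x v) :=
        mul_le_mul_of_nonneg_right (inner_cov_le z w) (inner_cov_nonneg x v)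
    _ = ‖w‖ ^ 2 * (spread z * inner ℝ v (cov x v)) := by ring

lemma norm_cov_sq_le (x : Fin J → Vec n) (v : Vec n) :
    ‖cov x v‖ ^ 2 ≤ spread x * inner ℝ v (cov x v) :=
  norm_crossCov_sq_le x x v

lemma mul_le_young {a s S η : ℝ} (hη : 0 < η) (hs : |s| ≤ S) :
    a * s ≤ η * a ^ 2 + S ^ 2 / (4 * η) := by
  have hsq : s ^ 2 ≤ S ^ 2 := sq_le_sq' (neg_le_of_abs_le hs) (le_of_abs_le hs)
  calc a * s = η * a ^ 2 + s ^ 2 / (4 * η) - (2 * η * a - s) ^ 2 / (4 * η) := by field_simp; ring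
    _ ≤ η * a ^ 2 + s ^ 2 / (4 * η) := sub_le_self _ (by positivity)
    _ ≤ η * a ^ 2 + S ^ 2 / (4 * η) := by gcongr

lemma mean_inner_mul_le (hJ : 0 < J) (x : Fin J → Vec n) (v : Vec n) {s : Fin J → ℝ} {S η : ℝ}
    (hη : 0 < η) (hs : ∀ j, |s j| ≤ S) :
    1 / (J : ℝ) * ∑ j, inner ℝ (x j - mean x) v * s j ≤
      η * inner ℝ v (cov x v) + S ^ 2 / (4 * η) := by
  calc 1 / (J : ℝ) * ∑ j, inner ℝ (x j - mean x) v * s j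
      ≤ 1 / (J : ℝ) * ∑ j, (η * inner ℝ (x j - mean x) v ^ 2 + S ^ 2 / (4 * η)) := by
        gcongr with j
        exact mul_le_young hη (hs j)
    _ = η * inner ℝ v (cov x v) + S ^ 2 / (4 * η) := by
        rw [inner_cov, Finset.sum_add_distrib, ← Finset.mul_sum, Finset.sum_const,
          Finset.card_univ, Fintype.card_fin, nsmul_eq_mul]
        field_simp

end Ensemble

section QuadraticRemainder

variable {E F : Type*} [NormedAddCommGroup E] [NormedSpace ℝ E] [NormedAddCommGroup F]
  [NormedSpace ℝ F] {G : E → F} {b : NNReal}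

/-- The linearisation error of `G` at every point is at most `b` times the squared distance. -/
def QuadraticRemainder (b : NNReal) (G : E → F) : Prop :=
  ∀ x z, ‖G x - G z - fderiv ℝ G z (x - z)‖ ≤ b * ‖x - z‖ ^ 2

lemma QuadraticRemainder.of_real {c : ℝ}
    (h : ∀ x z, ‖G x - G z - fderiv ℝ G z (x - z)‖ ≤ c * ‖x - z‖ ^ 2) :
    QuadraticRemainder c.toNNReal G := fun x z =>
  (h x z).trans (by gcongr; exact Real.le_coe_toNNReal c)

lemma QuadraticRemainder.norm_sub_le (hG : QuadraticRemainder b G) (x z : E) :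
    ‖G x - G z‖ ≤ (‖fderiv ℝ G z‖ + b * ‖x - z‖) * ‖x - z‖ :=
  calc ‖G x - G z‖ = ‖(G x - G z - fderiv ℝ G z (x - z)) + fderiv ℝ G z (x - z)‖ := by
        rw [sub_add_cancel]
    _ ≤ b * ‖x - z‖ ^ 2 + ‖fderiv ℝ G z‖ * ‖x - z‖ :=
        norm_add_le_of_le (hG x z) ((fderiv ℝ G z).le_opNorm _)
    _ = (‖fderiv ℝ G z‖ + b * ‖x - z‖) * ‖x - z‖ := by ring

lemma QuadraticRemainder.norm_fderiv_sub_le (hG : QuadraticRemainder b G) (x z : E) :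
    ‖fderiv ℝ G x - fderiv ℝ G z‖ ≤ 6 * b * ‖x - z‖ := by
  set r := ‖x - z‖ with hr
  rcases (norm_nonneg (x - z)).eq_or_lt' with hzero | hpos
  · simp [r, hzero, sub_eq_zero.mp (norm_eq_zero.mp hzero)]
  refine ContinuousLinearMap.opNorm_le_of_unit_norm (by positivity) fun v hv => ?_
  have hrv : ‖r • v‖ = r := by rw [norm_smul, hv, mul_one, Real.norm_of_nonneg hpos.le]
  -- Linearising `x + r • v` at `x` and at `z`, and `x` at `z`, expresses the difference of the
  -- derivatives in the direction `r • v` by three remainders.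
  have hsplit : r • (fderiv ℝ G x - fderiv ℝ G z) v =
      (G (x + r • v) - G z - fderiv ℝ G z (x + r • v - z))
        - (G (x + r • v) - G x - fderiv ℝ G x (x + r • v - x))
        - (G x - G z - fderiv ℝ G z (x - z)) := by
    rw [add_sub_cancel_left, add_sub_right_comm, map_add, map_smul, map_smul, sub_apply, smul_sub]
    abel
  have hfar : ‖x + r • v - z‖ ≤ 2 * r := by
    rw [add_sub_right_comm, two_mul]
    exact norm_add_le_of_le hr.ge hrv.le
  refine le_of_mul_le_mul_left ?_ hpos
  calc r * ‖(fderiv ℝ G x - fderiv ℝ G z) v‖ = ‖r • (fderiv ℝ G x - fderiv ℝ G z) v‖ := by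
        rw [norm_smul, Real.norm_of_nonneg hpos.le]
    _ ≤ b * ‖x + r • v - z‖ ^ 2 + b * ‖x + r • v - x‖ ^ 2 + b * ‖x - z‖ ^ 2 := by
        rw [hsplit]
        exact norm_sub_le_of_le (norm_sub_le_of_le (hG _ _) (hG _ _)) (hG _ _)
    _ ≤ b * (2 * r) ^ 2 + b * r ^ 2 + b * r ^ 2 := by
        rw [add_sub_cancel_left, hrv]
        gcongr
    _ = r * (6 * b * r) := by ring

end QuadraticRemainder

section Barrier

/-- First-order `μ`-strong convexity: `f` lies above each of its tangents by at least `μ / 2` times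
the squared distance. -/
def StrongConvexFirstOrder {E : Type*} [NormedAddCommGroup E] [InnerProductSpace ℝ E]
    [CompleteSpace E] (μ : ℝ) (f : E → ℝ) : Prop :=
  ∀ x z, inner ℝ (gradient f z) (x - z) + μ / 2 * ‖x - z‖ ^ 2 ≤ f x - f z

lemma inner_gradient_le_of_convexOn {E : Type*} [NormedAddCommGroup E] [InnerProductSpace ℝ E]
    [CompleteSpace E] {f : E → ℝ} (hf : ConvexOn ℝ Set.univ f) {x : E}
    (hd : DifferentiableAt ℝ f x) (w : E) : inner ℝ (gradient f x) (w - x) ≤ f w - f x := by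
  have hline : HasDerivAt (f ∘ AffineMap.lineMap (k := ℝ) x w) (fderiv ℝ f x (w - x)) 0 := by
    rw [← AffineMap.lineMap_apply_zero (k := ℝ) x w] at hd
    simpa only [AffineMap.lineMap_apply_zero] using
      hd.hasFDerivAt.comp_hasDerivAt (0 : ℝ) AffineMap.hasDerivAt_lineMap
  have hslope := (hf.comp_affineMap (AffineMap.lineMap x w)).le_slope_of_hasDerivAt
    (Set.mem_univ 0) (Set.mem_univ 1) one_pos hline
  rw [inner_gradient_left]
  simpa only [slope_def_field, Function.comp_apply, AffineMap.lineMap_apply_zero,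
    AffineMap.lineMap_apply_one, sub_zero, div_one] using hslope

variable {d m : ℕ} {Φ : Vec d → ℝ} {h : Fin m → Vec d → ℝ} {τ μ : ℝ} {v w x : Vec d}

/-- The gradient of the log-barrier potential at strictly feasible points. -/
noncomputable def barrierGrad (Φ : Vec d → ℝ) (h : Fin m → Vec d → ℝ) (τ : ℝ) (x : Vec d) :
    Vec d :=
  gradient Φ x - (1 / τ) • ∑ i, (1 / h i x) • gradient (h i) x

lemma inner_barrierGrad (x v : Vec d) :
    inner ℝ (barrierGrad Φ h τ x) v =
      inner ℝ (gradient Φ x) v - 1 / τ * ∑ i, 1 / h i x * inner ℝ (gradient (h i) x) v := by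
  simp only [barrierGrad, inner_sub_left, real_inner_smul_left, sum_inner]

lemma hasGradientAt_barrierPotential (hΦ : DifferentiableAt ℝ Φ x)
    (hh : ∀ i, DifferentiableAt ℝ (h i) x) (hx : StrictlyFeasible h x) :
    HasGradientAt (barrierPotential Φ h τ) (barrierGrad Φ h τ x) x := by
  have hlog : ∀ i ∈ Finset.univ, HasFDerivAt (fun z => Real.log (-(h i z)))
      ((-(h i x))⁻¹ • -(fderiv ℝ (h i) x)) x := fun i _ =>
    (hh i).hasFDerivAt.neg.log (neg_ne_zero.mpr (hx i).ne)
  rw [hasGradientAt_iff_hasFDerivAt]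
  refine (hΦ.hasFDerivAt.sub ((HasFDerivAt.fun_sum hlog).const_mul (1 / τ))).congr_fderiv ?_
  ext v
  simp [inner_barrierGrad, inner_gradient_left]

lemma log_sub_log_le {a b : ℝ} (ha : a < 0) (hb : b < 0) :
    Real.log (-a) - Real.log (-b) ≤ 1 / b * (a - b) := by
  rw [← Real.log_div (neg_ne_zero.mpr ha.ne) (neg_ne_zero.mpr hb.ne), neg_div_neg_eq, mul_sub,
    one_div_mul_eq_div, one_div_mul_cancel hb.ne]
  exact Real.log_le_sub_one_of_pos (div_pos_of_neg_of_neg ha hb)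

lemma inner_barrierGrad_sub_gradient_le (hτ : 0 < τ) (hhconv : ∀ i, ConvexOn ℝ Set.univ (h i))
    (hh : ∀ i, DifferentiableAt ℝ (h i) x) (hx : StrictlyFeasible h x)
    (hw : StrictlyFeasible h w) :
    inner ℝ (barrierGrad Φ h τ x) (w - x) - inner ℝ (gradient Φ x) (w - x) ≤
      (barrierPotential Φ h τ w - Φ w) - (barrierPotential Φ h τ x - Φ x) := by
  have hlog : ∑ i, (Real.log (-(h i w)) - Real.log (-(h i x))) ≤
      ∑ i, 1 / h i x * inner ℝ (gradient (h i) x) (w - x) :=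
    Finset.sum_le_sum fun i _ => (log_sub_log_le (hw i) (hx i)).trans <|
      mul_le_mul_of_nonpos_left (inner_gradient_le_of_convexOn (hhconv i) (hh i) w)
        (one_div_neg.mpr (hx i)).le
  have hscaled := mul_le_mul_of_nonneg_left hlog (one_div_pos.mpr hτ).le
  rw [Finset.sum_sub_distrib] at hscaled
  rw [inner_barrierGrad, barrierPotential, barrierPotential]
  linarith

lemma StrongConvexFirstOrder.barrierPotential_le (hΦ : StrongConvexFirstOrder μ Φ) (hτ : 0 < τ)
    (hhconv : ∀ i, ConvexOn ℝ Set.univ (h i)) (hh : ∀ i, DifferentiableAt ℝ (h i) x)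
    (hx : StrictlyFeasible h x) (hw : StrictlyFeasible h w) :
    inner ℝ (barrierGrad Φ h τ x) (w - x) + μ / 2 * ‖w - x‖ ^ 2 ≤
      barrierPotential Φ h τ w - barrierPotential Φ h τ x := by
  have hbarrier := inner_barrierGrad_sub_gradient_le (Φ := Φ) hτ hhconv hh hx hw
  linarith [hΦ w x]

lemma StrongConvexFirstOrder.polyakLojasiewicz (hΦ : StrongConvexFirstOrder μ Φ) (hμ : 0 ≤ μ)
    (hτ : 0 < τ) (hhconv : ∀ i, ConvexOn ℝ Set.univ (h i))
    (hh : ∀ i, DifferentiableAt ℝ (h i) x) (hx : StrictlyFeasible h x)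
    (hw : StrictlyFeasible h w) :
    2 * μ * (barrierPotential Φ h τ x - barrierPotential Φ h τ w) ≤
      ‖barrierGrad Φ h τ x‖ ^ 2 := by
  have htangent := mul_le_mul_of_nonneg_left (hΦ.barrierPotential_le hτ hhconv hh hx hw) hμ
  have hsquare := sq_nonneg ‖barrierGrad Φ h τ x + μ • (w - x)‖
  rw [norm_add_sq_real, real_inner_smul_right, norm_smul, Real.norm_of_nonneg hμ] at hsquare
  linarith

lemma IsBarrierMinimiser.barrierGrad_eq_zero (hv : IsBarrierMinimiser Φ h τ v)
    (hΦ : DifferentiableAt ℝ Φ v) (hh : ∀ i, DifferentiableAt ℝ (h i) v) :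
    barrierGrad Φ h τ v = 0 := by
  have hnhds : ∀ᶠ z in 𝓝 v, StrictlyFeasible h z := eventually_all.mpr fun i =>
    (hh i).continuousAt.eventually_lt continuousAt_const (hv.1 i)
  have hmin : IsLocalMin (barrierPotential Φ h τ) v := hnhds.mono fun z hz => hv.2 z hz
  simpa using hmin.hasFDerivAt_eq_zero (hasGradientAt_barrierPotential hΦ hh hv.1).hasFDerivAt

lemma IsBarrierMinimiser.norm_sub_sq_le (hv : IsBarrierMinimiser Φ h τ v)
    (hΦ : StrongConvexFirstOrder μ Φ) (hΦd : DifferentiableAt ℝ Φ v) (hτ : 0 < τ)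
    (hhconv : ∀ i, ConvexOn ℝ Set.univ (h i)) (hh : ∀ i, DifferentiableAt ℝ (h i) v)
    (hx : StrictlyFeasible h x) :
    μ / 2 * ‖x - v‖ ^ 2 ≤ barrierPotential Φ h τ x - barrierPotential Φ h τ v := by
  have htangent := hΦ.barrierPotential_le hτ hhconv hh hv.1 hx
  rwa [hv.barrierGrad_eq_zero hΦd hh, inner_zero_left, zero_add] at htangent

lemma IsBarrierMinimiser.objective_sub_le (hv : IsBarrierMinimiser Φ h τ v)
    (hΦ : DifferentiableAt ℝ Φ v) (hτ : 0 < τ) (hhconv : ∀ i, ConvexOn ℝ Set.univ (h i))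
    (hh : ∀ i, DifferentiableAt ℝ (h i) v) (hx : StrictlyFeasible h x) :
    Φ x - Φ v ≤ barrierPotential Φ h τ x - barrierPotential Φ h τ v
      + inner ℝ (gradient Φ v) (x - v) := by
  have hbarrier := inner_barrierGrad_sub_gradient_le (Φ := Φ) hτ hhconv hh hv.1 hx
  rw [hv.barrierGrad_eq_zero hΦ hh, inner_zero_left] at hbarrier
  linarith

end Barrier

section Forward

variable {d K : ℕ} {G : Vec d → Vec K} {y : Vec K} {Γ : Matrix (Fin K) (Fin K) ℝ}
  {C₀ : Matrix (Fin d) (Fin d) ℝ} {lam : ℝ}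

lemma hasFDerivAt_const_div_two_mul_inner {E F : Type*} [NormedAddCommGroup E] [NormedSpace ℝ E]
    [NormedAddCommGroup F] [InnerProductSpace ℝ F] {f : E → F} {f' : E →L[ℝ] F} {x : E}
    {T : F →L[ℝ] F} (c : ℝ) (hT : (T : F →ₗ[ℝ] F).IsSymmetric) (hf : HasFDerivAt f f' x) :
    HasFDerivAt (fun z => c / 2 * inner ℝ (f z) (T (f z))) (c • innerSL ℝ (T (f x)) ∘L f') x := by
  refine ((hf.inner ℝ (T.hasFDerivAt.comp x hf)).const_mul (c / 2)).congr_fderiv ?_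
  ext v
  have hsymm : inner ℝ (f x) (T (f' v)) = inner ℝ (T (f x)) (f' v) := (hT _ _).symm
  simp only [smul_apply, ContinuousLinearMap.comp_apply, ContinuousLinearMap.prod_apply,
    Function.comp_apply, fderivInnerCLM_apply, hsymm, real_inner_comm (T (f x)),
    coe_innerSL_apply, smul_eq_mul]
  ring

lemma hasFDerivAt_regPotential (hΓ : Γ.PosSemidef) (hC₀ : C₀.PosSemidef) {x : Vec d}
    (hG : DifferentiableAt ℝ G x) :
    HasFDerivAt (regPotential G y Γ C₀ lam)
      (innerSL ℝ (act Γ⁻¹ (G x - y)) ∘L fderiv ℝ G x + lam • innerSL ℝ (act C₀⁻¹ x)) x := by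
  have hmisfit := hasFDerivAt_const_div_two_mul_inner 1 (isPositive_act hΓ.inv).isSymmetric
    (hG.hasFDerivAt.sub_const y)
  have hreg := hasFDerivAt_const_div_two_mul_inner lam (isPositive_act hC₀.inv).isSymmetric
    (hasFDerivAt_id x)
  exact (hmisfit.add hreg).congr_fderiv (by rw [one_smul]; rfl)

lemma inner_gradient_regPotential (hΓ : Γ.PosSemidef) (hC₀ : C₀.PosSemidef) {x : Vec d}
    (hG : DifferentiableAt ℝ G x) (v : Vec d) :
    inner ℝ (gradient (regPotential G y Γ C₀ lam) x) v =
      inner ℝ (fderiv ℝ G x v) (act Γ⁻¹ (G x - y)) + lam * inner ℝ v (act C₀⁻¹ x) := by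
  rw [inner_gradient_left, (hasFDerivAt_regPotential hΓ hC₀ hG).fderiv,
    real_inner_comm (act Γ⁻¹ _), real_inner_comm (act C₀⁻¹ x)]
  rfl

end Forward

section Growth

variable {d K m : ℕ} {G : Vec d → Vec K} {y : Vec K} {Γ : Matrix (Fin K) (Fin K) ℝ}
  {C₀ : Matrix (Fin d) (Fin d) ℝ} {lam μ τ : ℝ} {b : NNReal} {Φ : Vec d → ℝ}
  {h : Fin m → Vec d → ℝ} {v : Vec d}

lemma norm_misfit_sq_le {g : ℝ} (hg : ∀ x : Vec K, g * ‖x‖ ^ 2 ≤ inner ℝ x (act Γ⁻¹ x))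
    (hC₀ : C₀.PosSemidef) (hlam : 0 ≤ lam) (x : Vec d) :
    g * ‖G x - y‖ ^ 2 ≤ 2 * regPotential G y Γ C₀ lam x := by
  have hreg := mul_nonneg hlam ((isPositive_act hC₀.inv).inner_nonneg_right x)
  rw [regPotential]
  linarith [hg (G x - y)]

lemma IsBarrierMinimiser.exists_norm_fderiv_sq_le (hv : IsBarrierMinimiser Φ h τ v)
    (hG : QuadraticRemainder b G) (hΦ : StrongConvexFirstOrder μ Φ) (hμ : 0 < μ)
    (hΦd : DifferentiableAt ℝ Φ v) (hτ : 0 < τ) (hhconv : ∀ i, ConvexOn ℝ Set.univ (h i))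
    (hh : ∀ i, DifferentiableAt ℝ (h i) v) :
    ∃ B : ℝ, 0 ≤ B ∧ ∀ x, StrictlyFeasible h x →
      ‖fderiv ℝ G x‖ ^ 2 ≤
        B * (1 + (barrierPotential Φ h τ x - barrierPotential Φ h τ v)) := by
  refine ⟨2 * ‖fderiv ℝ G v‖ ^ 2 + 144 * b ^ 2 / μ, by positivity, fun x hx => ?_⟩
  set gap := barrierPotential Φ h τ x - barrierPotential Φ h τ v
  have hgap : 0 ≤ gap := sub_nonneg.mpr (hv.2 x hx)
  have hdist : ‖x - v‖ ^ 2 ≤ 2 / μ * gap := by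
    rw [div_mul_eq_mul_div, le_div_iff₀ hμ]
    linarith [hv.norm_sub_sq_le hΦ hΦd hτ hhconv hh hx]
  have htriangle : ‖fderiv ℝ G x‖ ≤ ‖fderiv ℝ G v‖ + 6 * b * ‖x - v‖ :=
    norm_le_norm_add_const_of_dist_le (by rw [dist_eq_norm]; exact hG.norm_fderiv_sub_le x v)
  calc ‖fderiv ℝ G x‖ ^ 2 ≤ (‖fderiv ℝ G v‖ + 6 * b * ‖x - v‖) ^ 2 := by gcongr
    _ ≤ 2 * (‖fderiv ℝ G v‖ ^ 2 + (6 * b * ‖x - v‖) ^ 2) := add_sq_le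
    _ = 2 * ‖fderiv ℝ G v‖ ^ 2 + 72 * b ^ 2 * ‖x - v‖ ^ 2 := by ring
    _ ≤ 2 * ‖fderiv ℝ G v‖ ^ 2 + 72 * b ^ 2 * (2 / μ * gap) := by gcongr
    _ = 2 * ‖fderiv ℝ G v‖ ^ 2 * 1 + 144 * b ^ 2 / μ * gap := by ring
    _ ≤ 2 * ‖fderiv ℝ G v‖ ^ 2 * (1 + gap) + 144 * b ^ 2 / μ * (1 + gap) := by
        gcongr <;> linarith
    _ = (2 * ‖fderiv ℝ G v‖ ^ 2 + 144 * b ^ 2 / μ) * (1 + gap) := by ring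

lemma IsBarrierMinimiser.exists_objective_le (hv : IsBarrierMinimiser Φ h τ v)
    (hΦ : StrongConvexFirstOrder μ Φ) (hμ : 0 < μ) (hΦd : DifferentiableAt ℝ Φ v) (hτ : 0 < τ)
    (hhconv : ∀ i, ConvexOn ℝ Set.univ (h i)) (hh : ∀ i, DifferentiableAt ℝ (h i) v) :
    ∃ B : ℝ, 0 ≤ B ∧ ∀ x, StrictlyFeasible h x →
      Φ x ≤ B * (1 + (barrierPotential Φ h τ x - barrierPotential Φ h τ v)) := by
  set c := |Φ v| + ‖gradient Φ v‖ ^ 2 / 2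
  refine ⟨c + (1 + 1 / μ), by positivity, fun x hx => ?_⟩
  set gap := barrierPotential Φ h τ x - barrierPotential Φ h τ v
  have hgap : 0 ≤ gap := sub_nonneg.mpr (hv.2 x hx)
  have hdist : ‖x - v‖ ^ 2 / 2 ≤ 1 / μ * gap := by
    rw [one_div_mul_eq_div, le_div_iff₀ hμ]
    linarith [hv.norm_sub_sq_le hΦ hΦd hτ hhconv hh hx]
  have hcauchy : inner ℝ (gradient Φ v) (x - v) ≤ ‖gradient Φ v‖ ^ 2 / 2 + ‖x - v‖ ^ 2 / 2 := by
    linarith [real_inner_le_norm (gradient Φ v) (x - v),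
      two_mul_le_add_sq ‖gradient Φ v‖ ‖x - v‖]
  calc Φ x ≤ Φ v + gap + inner ℝ (gradient Φ v) (x - v) := by
        linarith [hv.objective_sub_le hΦd hτ hhconv hh hx]
    _ ≤ |Φ v| + gap + (‖gradient Φ v‖ ^ 2 / 2 + 1 / μ * gap) := by
        gcongr
        · exact le_abs_self _
        · exact hcauchy.trans (by gcongr)
    _ = c * 1 + (1 + 1 / μ) * gap := by ring
    _ ≤ c * (1 + gap) + (1 + 1 / μ) * (1 + gap) := by gcongr <;> linarith
    _ = (c + (1 + 1 / μ)) * (1 + gap) := by ring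

lemma IsBarrierMinimiser.exists_growth_sq_le
    (hv : IsBarrierMinimiser (regPotential G y Γ C₀ lam) h τ v) (hΓ : Γ.PosDef)
    (hC₀ : C₀.PosSemidef) (hlam : 0 ≤ lam) (hG : QuadraticRemainder b G)
    (hGd : DifferentiableAt ℝ G v) (hΦ : StrongConvexFirstOrder μ (regPotential G y Γ C₀ lam))
    (hμ : 0 < μ) (hτ : 0 < τ) (hhconv : ∀ i, ConvexOn ℝ Set.univ (h i))
    (hh : ∀ i, DifferentiableAt ℝ (h i) v) :
    ∃ B : ℝ, 0 ≤ B ∧ ∀ x, StrictlyFeasible h x →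
      (1 + ‖fderiv ℝ G x‖ + ‖G x - y‖) ^ 2 ≤
        B * (1 + (barrierPotential (regPotential G y Γ C₀ lam) h τ x
          - barrierPotential (regPotential G y Γ C₀ lam) h τ v)) := by
  obtain ⟨g, hg, hcoer⟩ := exists_coercive_act_inv hΓ
  have hΦd := (hasFDerivAt_regPotential (y := y) (lam := lam) hΓ.posSemidef hC₀
    hGd).differentiableAt
  obtain ⟨B₁, hB₁, hfderiv⟩ := hv.exists_norm_fderiv_sq_le hG hΦ hμ hΦd hτ hhconv hh
  obtain ⟨B₂, hB₂, hobjective⟩ := hv.exists_objective_le hΦ hμ hΦd hτ hhconv hh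
  refine ⟨3 * (1 + B₁ + 2 / g * B₂), by positivity, fun x hx => ?_⟩
  set gap := barrierPotential (regPotential G y Γ C₀ lam) h τ x
    - barrierPotential (regPotential G y Γ C₀ lam) h τ v
  have hgap : 0 ≤ gap := sub_nonneg.mpr (hv.2 x hx)
  have hmisfit : ‖G x - y‖ ^ 2 ≤ 2 / g * (B₂ * (1 + gap)) := by
    rw [div_mul_eq_mul_div, le_div_iff₀' hg]
    exact (norm_misfit_sq_le hcoer hC₀ hlam x).trans (by gcongr; exact hobjective x hx)
  calc (1 + ‖fderiv ℝ G x‖ + ‖G x - y‖) ^ 2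
      ≤ 3 * (1 ^ 2 + ‖fderiv ℝ G x‖ ^ 2 + ‖G x - y‖ ^ 2) := by
        nlinarith [sq_nonneg (1 - ‖fderiv ℝ G x‖), sq_nonneg (1 - ‖G x - y‖),
          sq_nonneg (‖fderiv ℝ G x‖ - ‖G x - y‖)]
    _ ≤ 3 * ((1 + gap) + B₁ * (1 + gap) + 2 / g * (B₂ * (1 + gap))) := by
        gcongr
        · linarith
        · exact hfderiv x hx
    _ = 3 * (1 + B₁ + 2 / g * B₂) * (1 + gap) := by ring

end Growth

section Drift

variable {d K m J : ℕ} {G : Vec d → Vec K} {y : Vec K} {Γ : Matrix (Fin K) (Fin K) ℝ}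
  {C₀ : Matrix (Fin d) (Fin d) ℝ} {lam ρ τ : ℝ} {h : Fin m → Vec d → ℝ} {b : NNReal}

lemma mean_inflatedDrift (hJ : 0 < J) (x : Fin J → Vec d) :
    mean (inflatedDrift G y Γ C₀ lam ρ 0 x) =
      -(crossCov x (fun k => G (x k)) (act Γ⁻¹ (mean (fun k => G (x k)) - y)))
        - lam • cov x (act C₀⁻¹ (mean x)) := by
  have hdrift : inflatedDrift G y Γ C₀ lam ρ 0 x = fun j =>
      -(crossCov x (fun k => G (x k)) ∘L act Γ⁻¹) (G (x j) - y)
        - (lam • cov x ∘L act C₀⁻¹) (x j)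
        + (ρ • crossCov x (fun k => G (x k)) ∘L act Γ⁻¹)
            (G (x j) - mean (fun k => G (x k))) := by
    ext1 j
    simp [inflatedDrift]
  rw [hdrift, mean_add, mean_sub, mean_neg, mean_map, mean_map, mean_map, mean_sub,
    mean_sub_mean hJ, mean_const hJ, map_zero, add_zero]
  rfl

lemma inflatedDrift_sub_mean (hJ : 0 < J) (x : Fin J → Vec d) (j : Fin J) :
    inflatedDrift G y Γ C₀ lam ρ 0 x j - mean (inflatedDrift G y Γ C₀ lam ρ 0 x) =
      -((1 - ρ) • crossCov x (fun k => G (x k)) (act Γ⁻¹ (G (x j) - mean (fun k => G (x k)))))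
        - lam • cov x (act C₀⁻¹ (x j - mean x)) := by
  rw [mean_inflatedDrift hJ, inflatedDrift]
  simp only [map_sub, smul_sub, sub_smul, one_smul, zero_mul, zero_smul]
  abel

lemma norm_mean_map_sub_le (hJ : 0 < J) (hG : QuadraticRemainder b G) (x : Fin J → Vec d) :
    ‖mean (fun k => G (x k)) - G (mean x)‖ ≤ b * spread x := by
  have hcentre : mean (fun k => G (x k)) - G (mean x) =
      mean (fun k => G (x k) - G (mean x) - fderiv ℝ G (mean x) (x k - mean x)) := by
    rw [mean_sub, mean_sub, mean_const hJ, mean_map, mean_sub_mean hJ, map_zero, sub_zero]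
  rw [hcentre, spread, mul_left_comm, Finset.mul_sum]
  exact norm_mean_le fun j => hG (x j) (mean x)

lemma norm_sub_mean_map_sub_fderiv_le (hJ : 0 < J) (hG : QuadraticRemainder b G)
    (x : Fin J → Vec d) (j : Fin J) :
    ‖G (x j) - mean (fun k => G (x k)) - fderiv ℝ G (mean x) (x j - mean x)‖ ≤
      b * (J + 1) * spread x := by
  have hsplit : G (x j) - mean (fun k => G (x k)) - fderiv ℝ G (mean x) (x j - mean x) =
      (G (x j) - G (mean x) - fderiv ℝ G (mean x) (x j - mean x))
        - (mean (fun k => G (x k)) - G (mean x)) := by abel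
  calc _ ≤ b * (J * spread x) + b * spread x := by
        rw [hsplit]
        exact norm_sub_le_of_le ((hG _ _).trans (by gcongr; exact norm_sub_mean_sq_le hJ x j))
          (norm_mean_map_sub_le hJ hG x)
    _ = b * (J + 1) * spread x := by ring

lemma norm_sub_mean_le_sqrt (hJ : 0 < J) (x : Fin J → Vec d) (j : Fin J) :
    ‖x j - mean x‖ ≤ √(J * spread x) :=
  Real.le_sqrt_of_sq_le (norm_sub_mean_sq_le hJ x j)

lemma spread_map_le (hJ : 0 < J) (hG : QuadraticRemainder b G) (x : Fin J → Vec d) :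
    spread (fun k => G (x k)) ≤
      (‖fderiv ℝ G (mean x)‖ + b * √(J * spread x)) ^ 2 * spread x := by
  refine (spread_le hJ _ (G (mean x))).trans ?_
  set r := √(J * spread x)
  have hr : ∀ j, ‖x j - mean x‖ ≤ r := norm_sub_mean_le_sqrt hJ x
  rw [spread, mul_left_comm, Finset.mul_sum _ _ (_ ^ 2)]
  gcongr with j
  rw [← mul_pow]
  gcongr
  refine (hG.norm_sub_le _ _).trans ?_
  gcongr
  exact hr j

/-- The factor by which particle `j` contributes to the discrepancy between the data-misfit drift
of the ensemble mean and the misfit part of the preconditioned gradient `Ĉ ∇Φ^reg`. -/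
noncomputable def linearisationError (G : Vec d → Vec K) (y : Vec K)
    (Γ : Matrix (Fin K) (Fin K) ℝ) (x : Fin J → Vec d) (j : Fin J) : ℝ :=
  inner ℝ (fderiv ℝ G (mean x) (x j - mean x)) (act Γ⁻¹ (G (mean x) - y))
    - inner ℝ (G (x j) - mean (fun k => G (x k))) (act Γ⁻¹ (mean (fun k => G (x k)) - y))

lemma linearisationError_eq (x : Fin J → Vec d) (j : Fin J) :
    linearisationError G y Γ x j =
      inner ℝ (fderiv ℝ G (mean x) (x j - mean x))
          (act Γ⁻¹ (G (mean x) - mean (fun k => G (x k))))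
        - inner ℝ (G (x j) - mean (fun k => G (x k)) - fderiv ℝ G (mean x) (x j - mean x))
          (act Γ⁻¹ (mean (fun k => G (x k)) - y)) := by
  simp only [linearisationError, inner_sub_left, map_sub, inner_sub_right]
  ring

lemma exists_abs_linearisationError_le (hJ : 0 < J) (hG : QuadraticRemainder b G) (y : Vec K)
    (Γ : Matrix (Fin K) (Fin K) ℝ) (q : ℝ) :
    ∃ c : ℝ, 0 ≤ c ∧ ∀ x : Fin J → Vec d, spread x ≤ q → ∀ j,
      |linearisationError G y Γ x j| ≤
        c * spread x * (1 + ‖fderiv ℝ G (mean x)‖ + ‖G (mean x) - y‖) := by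
  refine ⟨‖act Γ⁻¹‖ * b * (√(J * q) + (J + 1) * (1 + b * |q|)), by positivity,
    fun x hq j => ?_⟩
  set z := mean fun k => G (x k)
  set A := fderiv ℝ G (mean x)
  have hs := spread_nonneg x
  have hfst : |inner ℝ (A (x j - mean x)) (act Γ⁻¹ (G (mean x) - z))| ≤
      ‖A‖ * √(J * q) * (‖act Γ⁻¹‖ * (b * spread x)) := by
    refine (abs_real_inner_le_norm _ _).trans ?_
    gcongr
    · refine A.le_opNorm_of_le ((norm_sub_mean_le_sqrt hJ x j).trans ?_)
      gcongr
    · refine (act Γ⁻¹).le_opNorm_of_le ?_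
      rw [norm_sub_rev]
      exact norm_mean_map_sub_le hJ hG x
  have hsnd : |inner ℝ (G (x j) - z - A (x j - mean x)) (act Γ⁻¹ (z - y))| ≤
      b * (J + 1) * spread x * (‖act Γ⁻¹‖ * (b * |q| + ‖G (mean x) - y‖)) := by
    refine (abs_real_inner_le_norm _ _).trans ?_
    gcongr
    · exact norm_sub_mean_map_sub_fderiv_le hJ hG x j
    · refine (act Γ⁻¹).le_opNorm_of_le ?_
      rw [← sub_add_sub_cancel z (G (mean x)) y]
      refine norm_add_le_of_le ((norm_mean_map_sub_le hJ hG x).trans ?_) le_rfl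
      gcongr
      exact hq.trans (le_abs_self q)
  calc |linearisationError G y Γ x j|
      ≤ ‖act Γ⁻¹‖ * b * spread x *
          (√(J * q) * ‖A‖ + (J + 1) * (b * |q| + ‖G (mean x) - y‖)) := by
        rw [linearisationError_eq]
        exact (abs_sub _ _).trans ((add_le_add hfst hsnd).trans_eq (by ring))
    _ ≤ ‖act Γ⁻¹‖ * b * spread x *
          ((√(J * q) + (J + 1) * (1 + b * |q|)) * (1 + ‖A‖ + ‖G (mean x) - y‖)) := by
        gcongr
        have : 0 ≤ √(J * q) * (1 + ‖G (mean x) - y‖) := by positivity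
        have : 0 ≤ (J + 1) * (1 + ‖A‖ + b * |q| * (‖A‖ + ‖G (mean x) - y‖)) := by positivity
        linarith
    _ = _ := by ring

/-- The velocity of the mean of an ensemble `x` under the covariance-inflated log-barrier EKI flow;
the inflation term averages out. -/
noncomputable def meanDrift (G : Vec d → Vec K) (y : Vec K) (Γ : Matrix (Fin K) (Fin K) ℝ)
    (C₀ : Matrix (Fin d) (Fin d) ℝ) (lam : ℝ) (h : Fin m → Vec d → ℝ) (τ : ℝ)
    (x : Fin J → Vec d) : Vec d :=
  -(crossCov x (fun k => G (x k)) (act Γ⁻¹ (mean (fun k => G (x k)) - y)))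
    - lam • cov x (act C₀⁻¹ (mean x)) + barrierForce h τ x

lemma cov_barrierGrad (Φ : Vec d → ℝ) (x : Fin J → Vec d) :
    cov x (barrierGrad Φ h τ (mean x)) = cov x (gradient Φ (mean x)) - barrierForce h τ x := by
  rw [barrierGrad, map_sub, map_smul, barrierForce]

lemma inner_cov_gradient_regPotential (hΓ : Γ.PosSemidef) (hC₀ : C₀.PosSemidef)
    {x : Fin J → Vec d} (hG : DifferentiableAt ℝ G (mean x)) (n : Vec d) :
    inner ℝ n (cov x (gradient (regPotential G y Γ C₀ lam) (mean x))) =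
      inner ℝ n (crossCov x (fun k => G (x k)) (act Γ⁻¹ (mean (fun k => G (x k)) - y)))
        + lam * inner ℝ n (cov x (act C₀⁻¹ (mean x)))
        + 1 / (J : ℝ) * ∑ j, inner ℝ (x j - mean x) n * linearisationError G y Γ x j := by
  simp only [cov, inner_crossCov]
  rw [mul_left_comm lam, ← mul_add, ← mul_add, Finset.mul_sum Finset.univ _ lam,
    ← Finset.sum_add_distrib, ← Finset.sum_add_distrib]
  congr 1
  refine Finset.sum_congr rfl fun j _ => ?_
  rw [real_inner_comm (gradient _ _), inner_gradient_regPotential hΓ hC₀ hG, linearisationError]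
  ring

lemma inner_barrierGrad_meanDrift (hΓ : Γ.PosSemidef) (hC₀ : C₀.PosSemidef)
    {x : Fin J → Vec d} (hG : DifferentiableAt ℝ G (mean x)) :
    letI n := barrierGrad (regPotential G y Γ C₀ lam) h τ (mean x)
    inner ℝ n (meanDrift G y Γ C₀ lam h τ x) =
      -inner ℝ n (cov x n)
        + 1 / (J : ℝ) * ∑ j, inner ℝ (x j - mean x) n * linearisationError G y Γ x j := by
  rw [cov_barrierGrad]
  simp only [meanDrift, inner_add_right, inner_sub_right, inner_neg_right, real_inner_smul_right,
    inner_cov_gradient_regPotential hΓ hC₀ hG]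
  ring

end Drift

section Flow

variable {d K m J : ℕ} {G : Vec d → Vec K} {y : Vec K} {Γ : Matrix (Fin K) (Fin K) ℝ}
  {C₀ : Matrix (Fin d) (Fin d) ℝ} {lam : ℝ} {h : Fin m → Vec d → ℝ} {τ : ℝ} {ρ : ℝ → ℝ}
  {u : ℝ → Fin J → Vec d} {t q κ : ℝ}

lemma IsFlowSolution.hasDerivWithinAt_mean
    (hu : IsFlowSolution G y Γ C₀ lam h τ ρ (fun _ => 0) u) (hJ : 0 < J) (ht : 0 ≤ t) :
    HasDerivWithinAt (fun s => mean (u s)) (meanDrift G y Γ C₀ lam h τ (u t)) (Set.Ici 0) t := by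
  have hsum := (HasDerivWithinAt.fun_sum fun j (_ : j ∈ Finset.univ) =>
    hu.hasDeriv t ht j).const_smul (1 / (J : ℝ))
  have hadd := mean_add (inflatedDrift G y Γ C₀ lam (ρ t) 0 (u t))
    (fun _ => barrierForce h τ (u t))
  rw [mean_const hJ, mean_inflatedDrift hJ] at hadd
  exact hsum.congr_deriv hadd

lemma IsFlowSolution.hasDerivWithinAt_sub_mean
    (hu : IsFlowSolution G y Γ C₀ lam h τ ρ (fun _ => 0) u) (hJ : 0 < J) (ht : 0 ≤ t)
    (j : Fin J) :
    HasDerivWithinAt (fun s => u s j - mean (u s))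
      (-((1 - ρ t) • crossCov (u t) (fun k => G (u t k))
          (act Γ⁻¹ (G (u t j) - mean (fun k => G (u t k)))))
        - lam • cov (u t) (act C₀⁻¹ (u t j - mean (u t)))) (Set.Ici 0) t := by
  refine ((hu.hasDeriv t ht j).sub (hu.hasDerivWithinAt_mean hJ ht)).congr_deriv ?_
  rw [meanDrift, ← mean_inflatedDrift (ρ := ρ t) hJ, add_sub_add_right_eq_sub,
    inflatedDrift_sub_mean hJ]

lemma mean_inner_mul_inner_crossCov {n k : ℕ} (x : Fin J → Vec n) (z : Fin J → Vec k)
    (P : Vec k →L[ℝ] Vec k) (v : Vec n) :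
    1 / (J : ℝ) * ∑ j, inner ℝ (x j - mean x) v * inner ℝ (crossCov x z (P (z j - mean z))) v =
      inner ℝ (crossCov z x v) (P (crossCov z x v)) := by
  rw [← ContinuousLinearMap.adjoint_inner_left,
    inner_crossCov z x (ContinuousLinearMap.adjoint P (crossCov z x v)) v]
  congr 1
  refine Finset.sum_congr rfl fun j _ => ?_
  rw [real_inner_comm v (crossCov x z _), inner_crossCov_comm x z,
    ContinuousLinearMap.adjoint_inner_right, mul_comm]

/-- The rate of change of `⟨v, Ĉ v⟩` under the covariance-inflated flow at the ensemble `x`. -/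
noncomputable def covRate (G : Vec d → Vec K) (Γ : Matrix (Fin K) (Fin K) ℝ)
    (C₀ : Matrix (Fin d) (Fin d) ℝ) (lam ρ : ℝ) (x : Fin J → Vec d) (v : Vec d) : ℝ :=
  -(2 * (1 - ρ) * inner ℝ (crossCov (fun k => G (x k)) x v)
      (act Γ⁻¹ (crossCov (fun k => G (x k)) x v)))
    - 2 * lam * inner ℝ (cov x v) (act C₀⁻¹ (cov x v))

lemma IsFlowSolution.hasDerivWithinAt_inner_cov
    (hu : IsFlowSolution G y Γ C₀ lam h τ ρ (fun _ => 0) u) (hJ : 0 < J) (ht : 0 ≤ t)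
    (v : Vec d) :
    HasDerivWithinAt (fun s => inner ℝ v (cov (u s) v))
      (covRate G Γ C₀ lam (ρ t) (u t) v) (Set.Ici 0) t := by
  simp only [inner_cov]
  have hsum := (HasDerivWithinAt.fun_sum fun j (_ : j ∈ Finset.univ) =>
    ((hu.hasDerivWithinAt_sub_mean hJ ht j).inner ℝ (hasDerivWithinAt_const t _ v)).pow 2).const_mul
      (1 / (J : ℝ))
  refine hsum.congr_deriv ?_
  rw [covRate, ← mean_inner_mul_inner_crossCov, cov, ← mean_inner_mul_inner_crossCov]
  simp only [Finset.mul_sum, ← Finset.sum_neg_distrib, ← Finset.sum_sub_distrib]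
  refine Finset.sum_congr rfl fun j _ => ?_
  simp only [inner_zero_right, zero_add, inner_sub_left, inner_neg_left, real_inner_smul_left,
    Nat.cast_ofNat, pow_one, Nat.add_one_sub_one]
  ring

lemma IsFlowSolution.differentiableWithinAt_cov
    (hu : IsFlowSolution G y Γ C₀ lam h τ ρ (fun _ => 0) u) (hJ : 0 < J) (ht : 0 ≤ t) :
    DifferentiableWithinAt ℝ (fun s => cov (u s)) (Set.Ici 0) t := by
  refine (DifferentiableWithinAt.fun_sum fun j _ => ?_).const_smul (1 / (J : ℝ))
  have hdev := (hu.hasDerivWithinAt_sub_mean hJ ht j).differentiableWithinAt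
  exact (isBoundedBilinearMap_rankOne.differentiableAt
    (u t j - mean (u t), u t j - mean (u t))).comp_differentiableWithinAt t (hdev.prodMk hdev)

lemma covRate_le (hΓ : Γ.PosSemidef) (hlam : 0 ≤ lam) {ρ : ℝ} (hρ : ρ ≤ 1) {g : ℝ}
    (hcoer : ∀ x : Vec d, g * ‖x‖ ^ 2 ≤ inner ℝ x (act C₀⁻¹ x)) (x : Fin J → Vec d) (v : Vec d) :
    covRate G Γ C₀ lam ρ x v ≤ -(2 * lam * g) * ‖cov x v‖ ^ 2 := by
  have hmisfit := mul_nonneg (sub_nonneg.mpr hρ)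
    ((isPositive_act hΓ.inv).inner_nonneg_right (crossCov (fun k => G (x k)) x v))
  have hprior := mul_le_mul_of_nonneg_left (hcoer (cov x v)) hlam
  rw [covRate]
  linarith

lemma le_covRate (hlam : 0 ≤ lam) {ρ : ℝ} (hρ : ρ ≤ 1) (x : Fin J → Vec d)
    (hκ : spread (fun k => G (x k)) ≤ κ * spread x) (v : Vec d) :
    -((1 - ρ) * (2 * ‖act Γ⁻¹‖ * κ) * spread x * inner ℝ v (cov x v)
      + 2 * lam * ‖act C₀⁻¹‖ * ‖cov x v‖ ^ 2) ≤ covRate G Γ C₀ lam ρ x v := by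
  have hcross : inner ℝ (crossCov (fun k => G (x k)) x v)
      (act Γ⁻¹ (crossCov (fun k => G (x k)) x v)) ≤
      ‖act Γ⁻¹‖ * (κ * spread x * inner ℝ v (cov x v)) := by
    refine (inner_apply_le_opNorm _ _).trans ?_
    gcongr
    exact (norm_crossCov_sq_le x _ v).trans
      (mul_le_mul_of_nonneg_right hκ (inner_cov_nonneg x v))
  have hmisfit := mul_le_mul_of_nonneg_left hcross (sub_nonneg.mpr hρ)
  have hprior := mul_le_mul_of_nonneg_left (inner_apply_le_opNorm (act C₀⁻¹) (cov x v)) hlam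
  rw [covRate]
  linarith

lemma IsFlowSolution.exists_spread_le
    (hu : IsFlowSolution G y Γ C₀ lam h τ ρ (fun _ => 0) u) (hJ : 0 < J)
    (hΓ : Γ.PosSemidef) (hC₀ : C₀.PosDef) (hlam : 0 < lam) (hρ : ∀ t, 0 ≤ t → ρ t ≤ 1) :
    ∃ q : ℝ, 0 ≤ q ∧ ∀ t, 0 ≤ t → spread (u t) ≤ q / (t + 1) := by
  obtain ⟨g, hg, hcoer⟩ := exists_coercive_act_inv hC₀
  have ha : 0 < 2 * lam * g := by positivity
  let e := EuclideanSpace.basisFun (Fin d) ℝ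
  refine ⟨∑ i, max (inner ℝ (e i) (cov (u 0) (e i))) (1 / (2 * lam * g)),
    Finset.sum_nonneg fun i _ => le_max_of_le_right (by positivity), fun t ht => ?_⟩
  rw [spread_eq_sum_inner_cov e, Finset.sum_div]
  refine Finset.sum_le_sum fun i _ => le_max_div_of_deriv_le_neg_sq ha
    (fun s _ => inner_cov_nonneg _ _) (fun s hs => hu.hasDerivWithinAt_inner_cov hJ hs (e i))
    (fun s hs => ?_) ht
  have hentry : inner ℝ (e i) (cov (u s) (e i)) ≤ ‖cov (u s) (e i)‖ := by
    simpa only [e.norm_eq_one, one_mul] using real_inner_le_norm (e i) (cov (u s) (e i))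
  calc covRate G Γ C₀ lam (ρ s) (u s) (e i)
      ≤ -(2 * lam * g) * ‖cov (u s) (e i)‖ ^ 2 :=
        covRate_le hΓ hlam.le (hρ s hs) hcoer _ _
    _ ≤ -(2 * lam * g) * inner ℝ (e i) (cov (u s) (e i)) ^ 2 :=
        mul_le_mul_of_nonpos_left (pow_le_pow_left₀ (inner_cov_nonneg _ _) hentry 2)
          (neg_nonpos.mpr ha.le)

lemma IsFlowSolution.inner_cov_pos
    (hu : IsFlowSolution G y Γ C₀ lam h τ ρ (fun _ => 0) u) (hJ : 0 < J)
    (hlam : 0 ≤ lam) (hρ : ∀ t, 0 ≤ t → ρ t ∈ Set.Icc (0 : ℝ) 1)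
    (hq : ∀ t, 0 ≤ t → spread (u t) ≤ q) (hκ : 0 ≤ κ)
    (hspread : ∀ t, 0 ≤ t → spread (fun k => G (u t k)) ≤ κ * spread (u t))
    {v : Vec d} (hv : 0 < inner ℝ v (cov (u 0) v)) (ht : 0 ≤ t) :
    0 < inner ℝ v (cov (u t) v) := by
  set c := 2 * ‖act Γ⁻¹‖ * κ with hc
  set s₀ := 2 * lam * ‖act C₀⁻¹‖ with hs₀
  have hle := mul_exp_le_of_le_deriv (M := (c + s₀) * q)
    (fun s hs => hu.hasDerivWithinAt_inner_cov hJ hs v) (fun s hs => ?_) ht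
  · exact (mul_pos hv (Real.exp_pos _)).trans_le hle
  refine le_trans ?_ (le_covRate hlam (hρ s hs).2 (u s) (hspread s hs) v)
  have hform := inner_cov_nonneg (u s) v
  have hnonneg := spread_nonneg (u s)
  have hinflation : 1 - ρ s ≤ 1 := sub_le_self _ (hρ s hs).1
  rw [← hc, ← hs₀, neg_mul, neg_le_neg_iff]
  calc (1 - ρ s) * c * spread (u s) * inner ℝ v (cov (u s) v) + s₀ * ‖cov (u s) v‖ ^ 2
      ≤ 1 * c * q * inner ℝ v (cov (u s) v) + s₀ * (q * inner ℝ v (cov (u s) v)) := by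
        gcongr
        · exact hq s hs
        · exact (norm_cov_sq_le _ _).trans (mul_le_mul_of_nonneg_right (hq s hs) hform)
    _ = (c + s₀) * q * inner ℝ v (cov (u s) v) := by ring

lemma exists_div_one_sub_lt {s S : ℝ} (hs : 0 ≤ s) (hS : s < S) :
    ∃ ε : ℝ, 0 < ε ∧ ε < 1 ∧ s / (1 - ε) < S := by
  have hpos : 0 < S := hs.trans_lt hS
  have hsub : 1 - (S - s) / (2 * S) = (S + s) / (2 * S) := by field_simp; ring
  refine ⟨(S - s) / (2 * S), div_pos (sub_pos.mpr hS) (by positivity), ?_, ?_⟩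
  · rw [div_lt_one (by positivity)]
    linarith
  · rw [hsub, div_lt_iff₀ (by positivity)]
    field_simp
    linarith

lemma IsFlowSolution.eventually_norm_sq_le
    (hu : IsFlowSolution G y Γ C₀ lam h τ ρ (fun _ => 0) u) (hJ : 0 < J)
    (hlam : 0 ≤ lam) (hρ : ∀ t, 0 ≤ t → ρ t ∈ Set.Icc (0 : ℝ) 1) (hρlim : Tendsto ρ atTop (𝓝 1))
    (hq₀ : 0 ≤ q) (hq : ∀ t, 0 ≤ t → spread (u t) ≤ q / (t + 1)) (hκ : 0 ≤ κ)
    (hspread : ∀ t, 0 ≤ t → spread (fun k => G (u t k)) ≤ κ * spread (u t))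
    (hcov : ∀ z : Vec d, z ≠ 0 → 0 < inner ℝ z (cov (u 0) z))
    {S : ℝ} (hS : 2 * lam * ‖act C₀⁻¹‖ < S) :
    ∀ᶠ t in atTop, ∀ v : Vec d, ‖v‖ ^ 2 ≤ S * (t + 1) * inner ℝ v (cov (u t) v) := by
  obtain ⟨ε, hε, hε₁, hεS⟩ := exists_div_one_sub_lt (by positivity) hS
  have hsmall : ∀ᶠ t in atTop, (1 - ρ t) * (2 * ‖act Γ⁻¹‖ * κ) * q ≤ ε := by
    have hlim : Tendsto (fun t => (1 - ρ t) * (2 * ‖act Γ⁻¹‖ * κ) * q) atTop (𝓝 0) := by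
      simpa using ((hρlim.const_sub 1).mul_const (2 * ‖act Γ⁻¹‖ * κ)).mul_const q
    exact hlim.eventually_le_const hε
  obtain ⟨T, hT⟩ := eventually_atTop.mp (hsmall.and (eventually_ge_atTop 0))
  have hT₀ : 0 ≤ T := (hT T le_rfl).2
  have hsub : Set.Ici T ⊆ Set.Ici 0 := Set.Ici_subset_Ici.mpr hT₀
  have hunit : ∀ t ∈ Set.Ici T, IsUnit (cov (u t)) := fun t ht => isUnit_of_inner_pos fun v hv =>
    hu.inner_cov_pos hJ hlam hρ (fun s hs => (hq s hs).trans (div_le_self hq₀ (by linarith)))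
      hκ hspread (hcov v hv) (hsub ht)
  refine eventually_norm_sq_le_of_riccati hT₀ (by positivity) hε.le hε₁ hεS
    (fun t ht => (hu.differentiableWithinAt_cov hJ (hsub ht)).mono hsub)
    (fun t _ => isPositive_cov (u t)) hunit
    (fun t ht v => (hu.hasDerivWithinAt_inner_cov hJ (hsub ht) v).mono hsub) fun t ht v => ?_
  refine le_trans ?_ (le_covRate hlam (hρ t (hsub ht)).2 (u t) (hspread t (hsub ht)) v)
  have hinflation : 0 ≤ 1 - ρ t := sub_nonneg.mpr (hρ t (hsub ht)).2
  have hpos : 0 ≤ t + 1 := add_nonneg (hsub ht) zero_le_one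
  have hform := inner_cov_nonneg (u t) v
  gcongr
  calc (1 - ρ t) * (2 * ‖act Γ⁻¹‖ * κ) * spread (u t)
      ≤ (1 - ρ t) * (2 * ‖act Γ⁻¹‖ * κ) * (q / (t + 1)) := by gcongr; exact hq t (hsub ht)
    _ = (1 - ρ t) * (2 * ‖act Γ⁻¹‖ * κ) * q / (t + 1) := (mul_div_assoc _ _ _).symm
    _ ≤ ε / (t + 1) := by gcongr; exact (hT t ht).1

lemma IsFlowSolution.strictlyFeasible
    (hu : IsFlowSolution G y Γ C₀ lam h τ ρ (fun _ => 0) u) (hJ : 0 < J)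
    (hh : ∀ i, Continuous (h i)) (hmean : StrictlyFeasible h (mean (u 0))) (ht : 0 ≤ t) :
    StrictlyFeasible h (mean (u t)) := by
  intro i
  by_contra! hneg
  have hcont : ContinuousOn (fun s => h i (mean (u s))) (Set.Icc 0 t) := fun s hs =>
    (hh i).continuousAt.comp_continuousWithinAt
      ((hu.hasDerivWithinAt_mean hJ hs.1).continuousWithinAt.mono Set.Icc_subset_Ici_self)
  obtain ⟨s, hs, hzero⟩ := intermediate_value_Icc ht hcont ⟨(hmean i).le, hneg⟩
  exact hu.ne_zero s hs.1 i hzero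

lemma IsFlowSolution.hasDerivWithinAt_barrierPotential
    (hu : IsFlowSolution G y Γ C₀ lam h τ ρ (fun _ => 0) u) (hJ : 0 < J) (ht : 0 ≤ t)
    {Φ : Vec d → ℝ} (hΦ : DifferentiableAt ℝ Φ (mean (u t)))
    (hh : ∀ i, DifferentiableAt ℝ (h i) (mean (u t))) (hfeas : StrictlyFeasible h (mean (u t))) :
    HasDerivWithinAt (fun s => barrierPotential Φ h τ (mean (u s)))
      (inner ℝ (barrierGrad Φ h τ (mean (u t))) (meanDrift G y Γ C₀ lam h τ (u t)))
      (Set.Ici 0) t := by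
  have hgrad := hasGradientAt_iff_hasFDerivAt.mp
    (hasGradientAt_barrierPotential (τ := τ) hΦ hh hfeas)
  exact hgrad.comp_hasDerivWithinAt t (hu.hasDerivWithinAt_mean hJ ht)

end Flow

section Convergence

variable {d K m J : ℕ} {G : Vec d → Vec K} {y : Vec K} {Γ : Matrix (Fin K) (Fin K) ℝ}
  {C₀ : Matrix (Fin d) (Fin d) ℝ} {lam μ γ : ℝ} {b : NNReal} {h : Fin m → Vec d → ℝ} {τ : ℝ}
  {ρ : ℝ → ℝ} {u : ℝ → Fin J → Vec d} {q B : ℝ} {v : Vec d}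

lemma exists_inner_barrierGrad_meanDrift_le (hJ : 0 < J) (hΓ : Γ.PosSemidef)
    (hC₀ : C₀.PosSemidef) (hG : QuadraticRemainder b G) (hGd : Differentiable ℝ G) (q : ℝ) :
    ∃ A : ℝ, 0 ≤ A ∧ ∀ x : Fin J → Vec d, spread x ≤ q → ∀ η : ℝ, 0 < η →
      letI n := barrierGrad (regPotential G y Γ C₀ lam) h τ (mean x)
      inner ℝ n (meanDrift G y Γ C₀ lam h τ x) ≤
        -(1 - η) * inner ℝ n (cov x n)
          + A / η * spread x ^ 2 * (1 + ‖fderiv ℝ G (mean x)‖ + ‖G (mean x) - y‖) ^ 2 := by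
  obtain ⟨c, -, herror⟩ := exists_abs_linearisationError_le hJ hG y Γ q
  refine ⟨c ^ 2 / 4, by positivity, fun x hx η hη => ?_⟩
  rw [inner_barrierGrad_meanDrift hΓ hC₀ (hGd _)]
  refine (add_le_add_right (mean_inner_mul_le hJ x _ hη (herror x hx)) _).trans_eq ?_
  field_simp
  ring

lemma exists_inner_barrierGrad_meanDrift_le_of_spread_le (hJ : 0 < J) (hΓ : Γ.PosSemidef)
    (hC₀ : C₀.PosSemidef) (hG : QuadraticRemainder b G) (hGd : Differentiable ℝ G)
    (hq₀ : 0 ≤ q) :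
    ∃ A : ℝ, 0 ≤ A ∧ ∀ (x : Fin J → Vec d) (t W η : ℝ), 0 ≤ t → spread x ≤ q / (t + 1) →
      (1 + ‖fderiv ℝ G (mean x)‖ + ‖G (mean x) - y‖) ^ 2 ≤ W → 0 < η →
      letI n := barrierGrad (regPotential G y Γ C₀ lam) h τ (mean x)
      inner ℝ n (meanDrift G y Γ C₀ lam h τ x) ≤
        -(1 - η) * inner ℝ n (cov x n) + A * W / η / (t + 1) ^ 2 := by
  obtain ⟨A, hA, hdrift⟩ := exists_inner_barrierGrad_meanDrift_le (y := y) (C₀ := C₀) (lam := lam)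
    (h := h) (τ := τ) hJ hΓ hC₀ hG hGd q
  refine ⟨A * q ^ 2, by positivity, fun x t W η ht hx hW hη => ?_⟩
  refine (hdrift x (hx.trans (div_le_self hq₀ (by linarith))) η hη).trans ?_
  have hspread := spread_nonneg x
  calc _ ≤ -(1 - η) * _ + A / η * (q / (t + 1)) ^ 2 * W := by gcongr
    _ = _ := by field_simp

lemma IsFlowSolution.hasDerivWithinAt_gap
    (hu : IsFlowSolution G y Γ C₀ lam h τ ρ (fun _ => 0) u) (hJ : 0 < J)
    (hΓ : Γ.PosSemidef) (hC₀ : C₀.PosSemidef) (hGd : Differentiable ℝ G)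
    (hh : ∀ i, Differentiable ℝ (h i)) (hfeas : ∀ t, 0 ≤ t → StrictlyFeasible h (mean (u t)))
    (v : Vec d) {T t : ℝ} (hT : 0 ≤ T) (ht : t ∈ Set.Ici T) :
    HasDerivWithinAt (fun s => barrierPotential (regPotential G y Γ C₀ lam) h τ (mean (u s))
        - barrierPotential (regPotential G y Γ C₀ lam) h τ v)
      (inner ℝ (barrierGrad (regPotential G y Γ C₀ lam) h τ (mean (u t)))
        (meanDrift G y Γ C₀ lam h τ (u t))) (Set.Ici T) t :=
  ((hu.hasDerivWithinAt_barrierPotential hJ (hT.trans ht)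
    (hasFDerivAt_regPotential hΓ hC₀ (hGd _)).differentiableAt (fun i => hh i _)
    (hfeas t (hT.trans ht))).sub_const _).mono (Set.Ici_subset_Ici.mpr hT)

lemma IsFlowSolution.exists_growth_sq_le
    (hu : IsFlowSolution G y Γ C₀ lam h τ ρ (fun _ => 0) u) (hJ : 0 < J)
    (hΓ : Γ.PosSemidef) (hC₀ : C₀.PosSemidef) (hG : QuadraticRemainder b G)
    (hGd : Differentiable ℝ G) (hh : ∀ i, Differentiable ℝ (h i))
    (hfeas : ∀ t, 0 ≤ t → StrictlyFeasible h (mean (u t)))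
    (hq₀ : 0 ≤ q) (hq : ∀ t, 0 ≤ t → spread (u t) ≤ q / (t + 1)) (hB : 0 ≤ B)
    (hgrowth : ∀ x, StrictlyFeasible h x → (1 + ‖fderiv ℝ G x‖ + ‖G x - y‖) ^ 2 ≤
      B * (1 + (barrierPotential (regPotential G y Γ C₀ lam) h τ x
        - barrierPotential (regPotential G y Γ C₀ lam) h τ v))) :
    ∃ W : ℝ, ∀ t, 0 ≤ t →
      (1 + ‖fderiv ℝ G (mean (u t))‖ + ‖G (mean (u t)) - y‖) ^ 2 ≤ W := by
  obtain ⟨A, hA, hdrift⟩ := exists_inner_barrierGrad_meanDrift_le_of_spread_le (y := y) (C₀ := C₀)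
    (lam := lam) (h := h) (τ := τ) hJ hΓ hC₀ hG hGd hq₀
  have hinit := pos_of_mul_pos_right
    ((by positivity : (0 : ℝ) < _).trans_le (hgrowth _ (hfeas 0 le_rfl))) hB
  have hle : ∀ s ∈ Set.Ici (0 : ℝ),
      inner ℝ (barrierGrad (regPotential G y Γ C₀ lam) h τ (mean (u s)))
        (meanDrift G y Γ C₀ lam h τ (u s)) ≤
      A * B / (s + 1) ^ 2 * (1 + (barrierPotential (regPotential G y Γ C₀ lam) h τ (mean (u s))
        - barrierPotential (regPotential G y Γ C₀ lam) h τ v)) := fun s hs =>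
    (hdrift (u s) s _ 1 hs (hq s hs) (hgrowth _ (hfeas s hs)) one_pos).trans_eq (by ring)
  exact ⟨_, fun t ht => (hgrowth _ (hfeas t ht)).trans (mul_le_mul_of_nonneg_left
    (one_add_le_mul_exp_of_deriv_le (mul_nonneg hA hB) hinit.le
      (fun s hs => hu.hasDerivWithinAt_gap hJ hΓ hC₀ hGd hh hfeas v le_rfl hs) hle ht) hB)⟩

lemma IsFlowSolution.eventually_norm_sq_le_of_norm_fderiv_le
    (hu : IsFlowSolution G y Γ C₀ lam h τ ρ (fun _ => 0) u) (hJ : 0 < J)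
    (hlam : 0 ≤ lam) (hρ : ∀ t, 0 ≤ t → ρ t ∈ Set.Icc (0 : ℝ) 1) (hρlim : Tendsto ρ atTop (𝓝 1))
    (hG : QuadraticRemainder b G)
    (hq₀ : 0 ≤ q) (hq : ∀ t, 0 ≤ t → spread (u t) ≤ q / (t + 1))
    {R : ℝ} (hR : ∀ t, 0 ≤ t → ‖fderiv ℝ G (mean (u t))‖ ≤ R)
    (hcov : ∀ z : Vec d, z ≠ 0 → 0 < inner ℝ z (cov (u 0) z))
    {S : ℝ} (hS : 2 * lam * ‖act C₀⁻¹‖ < S) :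
    ∀ᶠ t in atTop, ∀ v : Vec d, ‖v‖ ^ 2 ≤ S * (t + 1) * inner ℝ v (cov (u t) v) := by
  refine hu.eventually_norm_sq_le hJ hlam hρ hρlim hq₀ hq (sq_nonneg (R + b * √(J * q)))
    (fun t ht => (spread_map_le hJ hG (u t)).trans ?_) hcov hS
  have hspread := spread_nonneg (u t)
  gcongr
  · exact hR t ht
  · exact (hq t ht).trans (div_le_self hq₀ (by linarith))

lemma mul_rpow_neg_one_div {c s : ℝ} (hc : 0 ≤ c) (hs : 0 ≤ s) (hγ : γ ≠ 0) :
    c * s ^ (-(1 / γ)) = (c ^ γ / s) ^ (1 / γ) := by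
  rw [Real.div_rpow (by positivity) hs, ← Real.rpow_mul hc, mul_one_div_cancel hγ, Real.rpow_one,
    Real.rpow_neg hs, ← div_eq_mul_inv]

lemma IsFlowSolution.exists_gap_le_rpow
    (hu : IsFlowSolution G y Γ C₀ lam h τ ρ (fun _ => 0) u) (hJ : 0 < J)
    (hΓ : Γ.PosDef) (hC₀ : C₀.PosDef) (hlam : 0 < lam)
    (hρ : ∀ t, 0 ≤ t → ρ t ∈ Set.Icc (0 : ℝ) 1) (hρlim : Tendsto ρ atTop (𝓝 1))
    (hG : QuadraticRemainder b G) (hGd : Differentiable ℝ G)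
    (hΦ : StrongConvexFirstOrder μ (regPotential G y Γ C₀ lam)) (hμ : 0 < μ) (hτ : 0 < τ)
    (hhconv : ∀ i, ConvexOn ℝ Set.univ (h i)) (hh : ∀ i, Differentiable ℝ (h i))
    (hfeas : ∀ t, 0 ≤ t → StrictlyFeasible h (mean (u t)))
    (hcov : ∀ z : Vec d, z ≠ 0 → 0 < inner ℝ z (cov (u 0) z))
    (hv : IsBarrierMinimiser (regPotential G y Γ C₀ lam) h τ v)
    (hγ₁ : 1 < γ) (hγ : lam * ‖act C₀⁻¹‖ < μ * γ) :
    ∃ c T : ℝ, 0 < c ∧ 0 ≤ T ∧ ∀ t, T ≤ t →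
      barrierPotential (regPotential G y Γ C₀ lam) h τ (mean (u t))
        - barrierPotential (regPotential G y Γ C₀ lam) h τ v ≤ c * (t + 1) ^ (-(1 / γ)) := by
  obtain ⟨B, hB, hgrowth⟩ := hv.exists_growth_sq_le hΓ hC₀.posSemidef hlam.le hG (hGd v) hΦ hμ hτ
    hhconv fun i => hh i v
  obtain ⟨q, hq₀, hq⟩ := hu.exists_spread_le hJ hΓ.posSemidef hC₀ hlam fun t ht => (hρ t ht).2
  obtain ⟨W, hW⟩ := hu.exists_growth_sq_le hJ hΓ.posSemidef hC₀.posSemidef hG hGd hh hfeas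
    hq₀ hq hB hgrowth
  obtain ⟨A, hA, hdrift⟩ := exists_inner_barrierGrad_meanDrift_le_of_spread_le (y := y) (C₀ := C₀)
    (lam := lam) (h := h) (τ := τ) hJ hΓ.posSemidef hC₀.posSemidef hG hGd hq₀
  have hfderiv : ∀ t, 0 ≤ t → ‖fderiv ℝ G (mean (u t))‖ ≤ √W := fun t ht =>
    (Real.le_sqrt_of_sq_le (hW t ht)).trans' (by linarith [norm_nonneg (G (mean (u t)) - y)])
  set S := lam * ‖act C₀⁻¹‖ + μ * γ with hS
  have hS₀ : 0 < S := by positivity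
  obtain ⟨T, hT⟩ := eventually_atTop.mp ((hu.eventually_norm_sq_le_of_norm_fderiv_le hJ hlam.le
    hρ hρlim hG hq₀ hq hfderiv hcov (S := S) (by linarith [hS])).and (eventually_ge_atTop 0))
  have hT₀ : 0 ≤ T := (hT T le_rfl).2
  have hdissipation : ∀ t ∈ Set.Ici T,
      2 * μ / S * (barrierPotential (regPotential G y Γ C₀ lam) h τ (mean (u t))
        - barrierPotential (regPotential G y Γ C₀ lam) h τ v) ≤
      (t + 1) * inner ℝ (barrierGrad (regPotential G y Γ C₀ lam) h τ (mean (u t)))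
        (cov (u t) (barrierGrad (regPotential G y Γ C₀ lam) h τ (mean (u t)))) := fun t ht => by
    rw [div_mul_eq_mul_div, div_le_iff₀ hS₀]
    refine ((hΦ.polyakLojasiewicz hμ.le hτ hhconv (fun i => hh i _)
      (hfeas t (hT₀.trans ht)) hv.1).trans ((hT t ht).1 _)).trans_eq ?_
    ring
  obtain ⟨c, hc, hle⟩ := exists_le_rpow_of_dissipation (α := 1 / γ) (by positivity)
    ((div_lt_one (by positivity)).mpr hγ₁)
    (by rw [div_lt_div_iff₀ (by positivity) hS₀]; linarith)
    (mul_nonneg hA ((sq_nonneg _).trans (hW 0 le_rfl))) hT₀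
    (fun t ht => hu.hasDerivWithinAt_gap hJ hΓ.posSemidef hC₀.posSemidef hGd hh hfeas v hT₀ ht)
    (fun t ht η hη => hdrift (u t) t W η (hT₀.trans ht) (hq t (hT₀.trans ht))
      (hW t (hT₀.trans ht)) hη) hdissipation
  exact ⟨c, T, hc, hT₀, hle⟩

end Convergence

end EKI

theorem mainTheorem1_general {d K m J : ℕ}
    (G : EKI.Vec d → EKI.Vec K) (y : EKI.Vec K)
    (Γ : Matrix (Fin K) (Fin K) ℝ) (hΓ : Γ.PosDef)
    (C₀ : Matrix (Fin d) (Fin d) ℝ) (hC₀ : C₀.PosDef)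
    (lam : ℝ) (hlam : 0 < lam) (μ : ℝ) (hμ : 0 < μ)
    (hconv : EKI.StrongConvexFirstOrder μ (EKI.regPotential G y Γ C₀ lam))
    (hGdiff : Differentiable ℝ G) (b : NNReal) (hG : EKI.QuadraticRemainder b G)
    (h : Fin m → EKI.Vec d → ℝ)
    (hhconv : ∀ i, ConvexOn ℝ Set.univ (h i)) (hhdiff : ∀ i, Differentiable ℝ (h i))
    (τ : ℝ) (hτ : 0 < τ)
    (ρ : ℝ → ℝ) (hρ : ∀ t, 0 ≤ t → ρ t ∈ Set.Icc (0 : ℝ) 1) (hρlim : Tendsto ρ atTop (𝓝 1))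
    (hJ : 0 < J)
    (u : ℝ → Fin J → EKI.Vec d)
    (hu : EKI.IsFlowSolution G y Γ C₀ lam h τ ρ (fun _ => 0) u)
    (hmean : EKI.StrictlyFeasible h (EKI.mean (u 0)))
    (hcov : ∀ z : EKI.Vec d, z ≠ 0 → 0 < inner ℝ z (EKI.cov (u 0) z))
    (ustar : EKI.Vec d)
    (hustar : EKI.IsBarrierMinimiser (EKI.regPotential G y Γ C₀ lam) h τ ustar) :
    (∀ t, 0 ≤ t → EKI.StrictlyFeasible h (EKI.mean (u t))) ∧
    (∀ γ : ℝ, max 1 (lam * ‖EKI.act C₀⁻¹‖ / μ) < γ →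
      ∃ c₁ c₂ tbar : ℝ, 0 < c₁ ∧ 0 < c₂ ∧ 0 ≤ tbar ∧ ∀ t : ℝ, tbar ≤ t →
        EKI.barrierPotential (EKI.regPotential G y Γ C₀ lam) h τ (EKI.mean (u t))
          - EKI.barrierPotential (EKI.regPotential G y Γ C₀ lam) h τ ustar
          ≤ (c₁ / (t + c₂)) ^ (1 / γ)) ∧
    Tendsto (fun t =>
        EKI.barrierPotential (EKI.regPotential G y Γ C₀ lam) h τ (EKI.mean (u t))
          - EKI.barrierPotential (EKI.regPotential G y Γ C₀ lam) h τ ustar)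
      atTop (𝓝 0) := by
  have hfeas : ∀ t, 0 ≤ t → EKI.StrictlyFeasible h (EKI.mean (u t)) := fun t ht =>
    hu.strictlyFeasible hJ (fun i => (hhdiff i).continuous) hmean ht
  have hrate : ∀ γ : ℝ, max 1 (lam * ‖EKI.act C₀⁻¹‖ / μ) < γ →
      ∃ c₁ c₂ tbar : ℝ, 0 < c₁ ∧ 0 < c₂ ∧ 0 ≤ tbar ∧ ∀ t : ℝ, tbar ≤ t →
        EKI.barrierPotential (EKI.regPotential G y Γ C₀ lam) h τ (EKI.mean (u t))
          - EKI.barrierPotential (EKI.regPotential G y Γ C₀ lam) h τ ustar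
          ≤ (c₁ / (t + c₂)) ^ (1 / γ) := by
    intro γ hγ
    obtain ⟨hγ₁, hγμ⟩ := max_lt_iff.mp hγ
    obtain ⟨c, T, hc, hT, hle⟩ := hu.exists_gap_le_rpow hJ hΓ hC₀ hlam hρ hρlim hG hGdiff hconv
      hμ hτ hhconv hhdiff hfeas hcov hustar hγ₁ ((div_lt_iff₀' hμ).mp hγμ)
    refine ⟨c ^ γ, 1, T, by positivity, one_pos, hT, fun t ht => (hle t ht).trans_eq ?_⟩
    exact EKI.mul_rpow_neg_one_div hc.le (by linarith) (by positivity)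
  obtain ⟨c₁, c₂, T, -, -, -, hle⟩ := hrate _ (lt_add_one _)
  exact ⟨hfeas, hrate, EKI.tendsto_zero_of_le_div_rpow (by positivity)
    (fun t ht => sub_nonneg.mpr (hustar.2 _ (hfeas t ht))) hle⟩

theorem mainTheorem1 {d K m J : ℕ}
    (G : EKI.Vec d → EKI.Vec K) (y : EKI.Vec K)
    (Γ : Matrix (Fin K) (Fin K) ℝ) (hΓ : Γ.PosDef)
    (C₀ : Matrix (Fin d) (Fin d) ℝ) (hC₀ : C₀.PosDef)
    (lam : ℝ) (hlam : 0 < lam)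
    -- the regularised potential is C², μ-strongly convex and L-smooth
    (hΦ : ContDiff ℝ 2 (EKI.regPotential G y Γ C₀ lam))
    (μ : ℝ) (hμ : 0 < μ)
    (hconv : ∀ x₁ x₂ : EKI.Vec d,
      inner ℝ (gradient (EKI.regPotential G y Γ C₀ lam) x₂) (x₁ - x₂) + μ / 2 * ‖x₁ - x₂‖ ^ 2
        ≤ EKI.regPotential G y Γ C₀ lam x₁ - EKI.regPotential G y Γ C₀ lam x₂)
    (L : ℝ) (hL : 0 < L)
    (hsmooth : ∀ x₁ x₂ : EKI.Vec d,
      ‖gradient (EKI.regPotential G y Γ C₀ lam) x₁ - gradient (EKI.regPotential G y Γ C₀ lam) x₂‖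
        ≤ L * ‖x₁ - x₂‖)
    -- the forward map is locally Lipschitz with a quadratic linearisation error
    (hGlip : LocallyLipschitz G) (hGdiff : Differentiable ℝ G)
    (bres : ℝ)
    (hres : ∀ x₁ x₂ : EKI.Vec d,
      ‖G x₁ - G x₂ - fderiv ℝ G x₂ (x₁ - x₂)‖ ≤ bres * ‖x₁ - x₂‖ ^ 2)
    -- convex C¹ constraints with a strictly feasible point
    (h : Fin m → EKI.Vec d → ℝ)
    (hhconv : ∀ i, ConvexOn ℝ Set.univ (h i)) (hhdiff : ∀ i, ContDiff ℝ 1 (h i))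
    (hslater : ∃ v, EKI.StrictlyFeasible h v)
    (τ : ℝ) (hτ : 0 < τ)
    -- inflation factor of the data misfit; the regularisation term is not inflated
    (ρ : ℝ → ℝ) (hρ : ∀ t, 0 ≤ t → ρ t ∈ Set.Icc (0 : ℝ) 1) (hρlim : Tendsto ρ atTop (𝓝 1))
    -- a solution of the flow whose initial mean is strictly feasible and whose initial
    -- empirical covariance is nondegenerate
    (hJ : d < J)
    (u : ℝ → Fin J → EKI.Vec d)
    (hu : EKI.IsFlowSolution G y Γ C₀ lam h τ ρ (fun _ => 0) u)
    (hmean : EKI.StrictlyFeasible h (EKI.mean (u 0)))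
    (hcov : ∀ z : EKI.Vec d, z ≠ 0 → 0 < inner ℝ z (EKI.cov (u 0) z))
    (ustar : EKI.Vec d)
    (hustar : EKI.IsBarrierMinimiser (EKI.regPotential G y Γ C₀ lam) h τ ustar) :
    (∀ t, 0 ≤ t → EKI.StrictlyFeasible h (EKI.mean (u t))) ∧
    (∀ γ : ℝ, max 1 (lam * ‖EKI.act C₀⁻¹‖ / μ) < γ →
      ∃ c₁ c₂ tbar : ℝ, 0 < c₁ ∧ 0 < c₂ ∧ 0 ≤ tbar ∧ ∀ t : ℝ, tbar ≤ t →
        EKI.barrierPotential (EKI.regPotential G y Γ C₀ lam) h τ (EKI.mean (u t))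
          - EKI.barrierPotential (EKI.regPotential G y Γ C₀ lam) h τ ustar
          ≤ (c₁ / (t + c₂)) ^ (1 / γ)) ∧
    Tendsto (fun t =>
        EKI.barrierPotential (EKI.regPotential G y Γ C₀ lam) h τ (EKI.mean (u t))
          - EKI.barrierPotential (EKI.regPotential G y Γ C₀ lam) h τ ustar)
      atTop (𝓝 0) :=
  mainTheorem1_general G y Γ hΓ C₀ hC₀ lam hlam μ hμ hconv hGdiff _ (.of_real hres) h hhconv
    (fun i => (hhdiff i).differentiable one_ne_zero) τ hτ ρ hρ hρlim ((Nat.zero_le d).trans_lt hJ)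
    u hu hmean hcov ustar hustar
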